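/- **Setting.** Let $\mathfrak g$ be a finite-dimensional simple complex Lie algebra of rank $r$ with Cartan subalgebra $\mathfrak h$, Chevalley generators $e_j,f_j,\check\alpha_j$, simple roots $\alpha_j$ and Cartan matrix $a_{jk}=\langle\alpha_k,\check\alpha_j\rangle$; let $G$ be the simply connected group of $\mathfrak g$, and $B_\pm\subset G$ the Borel subgroups with Lie algebras $\mathfrak b_+=\langle e_j,\check\alpha_j\rangle$, $\mathfrak b_-=\langle f_j,\check\alpha_j\rangle$. Let $\mathfrak n_+=\langle e_j\rangle$. Fix monic polynomials $\Lambda_1,\dots,\Lambda_r\in\mathbb C[z]$ and $Z=\sum_j\zeta_j\check\alpha_j\in\mathfrak h$. Put $s_i(Z)=Z-\langle\alpha_i,Z\rangle\check\alpha_i$ and $W(p,q)=p\,q'-q\,p'$. *Solutions.* A polynomial solution of the $qq$-system for $Z$ is a family $q^j_\pm\in\mathbb C[z]$ with $$W(q^j_+,q^j_-)+\langle\alpha_j,Z\rangle q^j_+q^j_-=\Lambda_j\prod_{k\ne j}(q^k_+)^{-a_{kj}}\qquad(j=1,\dots,r).$$ Nonzero rational functions $y_1,\dots,y_r$ satisfy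 the *nondegeneracy conditions* if no $y_j$ has a multiple zero or pole, the roots of $\Lambda_j$ are distinct from the zeros and poles of $y_j$, and $y_j,y_k$ have no common element among their zeros and poles when $j\ne k$ and $a_{jk}\neq0$. A solution is *nondegenerate* if all $q^j_+$ are monic and $(q^j_+)_j$ satisfies the nondegeneracy conditions. It is *$i$-generic* if it is nondegenerate and the family obtained from $(q^j_+)_j$ by replacing $q^i_+$ with $q^i_-$ satisfies the nondegeneracy conditions. It is *$i$-composable* if that family is the positive part of some polynomial solution for $s_i(Z)$. *Opers.* A connection $\partial_z+A$, $A\in\mathfrak g(z)$, on the trivial $G$-bundle with the standard reductions to $B_\pm$ is a Miura oper (with singularities given by the $\Lambda_j$) if $A\in\sum_j\Lambda_je_j+\mathfrak b_-(z)$ and $A\in\mathfrak b_+(z)$. Let $V_j$ be the irreducible representation with highest weight the fundamental weight $\omega_j$, $\nu_j$ a highest weight vector, and $W_j=\mathrm{span}(\nu_j,f_j\nu_j)$. The Miura oper is a *$Z$-twisted Miura–Plücker oper* if there is $v(z)\in B_+(z)$ such that, for all $j$, $\partial_z+A$ and $v(z)(\partial_z+Z)v(z)^{-1}$ coincide on $W_j(z)$.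 It is *nondegenerate* if the class of $A$ in $(\mathfrak b_+/\mathfrak n_+)(z)$ is $\sum_j(\zeta_j-y_j^{-1}y_j')\check\alpha_j$ with rational functions $y_j$ that satisfy the nondegeneracy conditions, and, for every $j$, the $\mathrm{SL}(2)$-oper $\partial_z+(\zeta_j-y_j^{-1}y_j')\check\alpha+\rho_je$ with $\rho_j=\Lambda_j\prod_{k\ne j}y_k^{-a_{kj}}$ is nondegenerate, i.e. $\rho_j$ and $y_j$ are polynomials without common roots and $y_j$ has no multiple roots. To a solution for $Z$ is attached the connection $$\nabla_{q_+,Z}=\partial_z+\sum_j\Bigl(\zeta_j-\frac{(q^j_+)'}{q^j_+}\Bigr)\check\alpha_j+\sum_j\Lambda_je_j ,$$ and $\nabla^{(i)}=e^{\mu_if_i}\,\nabla_{q_+,Z}\,e^{-\mu_if_i}$ with $\mu_i=\Lambda_i^{-1}\bigl(\partial_z\log(q^i_- /q^i_+)+\langle\alpha_i,Z\rangle\bigr)$. A polynomial solution $\{\tilde q^j_\pm\}$ for $s_i(Z)$ *corresponds* to $\nabla^{(i)}$ if $\nabla_{\tilde q_+,s_i(Z)}=\nabla^{(i)}$. **Lemma.**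 Let $\{q^j_\pm\}$ be an $i$-generic polynomial solution of the $qq$-system for $Z$, and let $c\ne0$ be the leading coefficient of $q^i_-$. Then: 0. The solution is $i$-composable. 1. $\nabla^{(i)}$ is a nondegenerate $s_i(Z)$-twisted Miura–Plücker oper. 2. Every polynomial solution $\{\tilde q^j_\pm\}$ for $s_i(Z)$ that corresponds to $\nabla^{(i)}$ and has all $\tilde q^j_+$ monic is nondegenerate, and $\tilde q^j_+=q^j_+$ for $j\neq i$ and $c\,\tilde q^i_+=q^i_-$ (so $\tilde q^i_+=q^i_-$ up to the monic normalization). 3. One may take $\tilde q^i_-=-q^i_+$: there is a polynomial solution for $s_i(Z)$ corresponding to $\nabla^{(i)}$ with $\tilde q^j_+=q^j_+$ ($j\ne i$), $\tilde q^i_+=q^i_-$ and $\tilde q^i_-=-q^i_+$. In the monic normalization, there is a nondegenerate one with $\tilde q^j_+=q^j_+$ ($j\ne i$), $c\,\tilde q^i_+=q^i_-$ and $\tilde q^i_-=-c\,q^i_+$. -/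

import Mathlib

open Polynomial TensorProduct

noncomputable section

namespace MiuraPlucker

/-! ### Rational functions in one variable `z` over `ℂ` -/

/-- The field `ℂ(z)` of rational functions. -/
abbrev Rat1 : Type := RatFunc ℂ

/-- A polynomial, viewed as a rational function. -/
abbrev toRat (p : ℂ[X]) : Rat1 := algebraMap ℂ[X] Rat1 p

/-- The derivative of a rational function, by the quotient rule for the reduced fraction. -/
def ratDerivFun (f : Rat1) : Rat1 :=
  (toRat (derivative f.num) * toRat f.denom - toRat f.num * toRat (derivative f.denom)) /
    toRat f.denom ^ 2

theorem toRat_ne_zero {p : ℂ[X]} (hp : p ≠ 0) : toRat p ≠ 0 := by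
  simpa [toRat] using hp

theorem toRat_smul (c : ℂ) (p : ℂ[X]) : toRat (c • p) = c • toRat p :=
  map_smul (IsScalarTower.toAlgHom ℂ ℂ[X] Rat1) c p

/-- The quotient rule holds for every (not necessarily reduced) fraction. -/
theorem ratDerivFun_div (p q : ℂ[X]) (hq : q ≠ 0) :
    ratDerivFun (toRat p / toRat q) =
      (toRat (derivative p) * toRat q - toRat p * toRat (derivative q)) / toRat q ^ 2 := by
  set f : Rat1 := toRat p / toRat q with hf
  have hd : toRat f.denom ≠ 0 := toRat_ne_zero f.denom_ne_zero
  have hq' : toRat q ≠ 0 := toRat_ne_zero hq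
  have h1 : toRat f.num / toRat f.denom = toRat p / toRat q := f.num_div_denom
  have h2 : toRat f.num * toRat q = toRat p * toRat f.denom := by
    rwa [div_eq_div_iff hd hq'] at h1
  have h3 : f.num * q = p * f.denom := by
    apply IsFractionRing.injective ℂ[X] Rat1
    simpa [toRat] using h2
  have h4 : toRat (derivative f.num) * toRat q + toRat f.num * toRat (derivative q) =
      toRat (derivative p) * toRat f.denom + toRat p * toRat (derivative f.denom) := by
    have := congrArg (fun r => toRat (derivative r)) h3
    simpa [toRat, derivative_mul] using this
  unfold ratDerivFun
  rw [div_eq_div_iff (pow_ne_zero 2 hd) (pow_ne_zero 2 hq')]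
  linear_combination (toRat f.denom * toRat q) * h4 - (toRat f.denom * toRat (derivative q)
    + toRat q * toRat (derivative f.denom)) * h2

/-- The derivation `∂_z` of `ℂ(z)`. -/
def ratDeriv : Derivation ℂ Rat1 Rat1 :=
  Derivation.mk'
    { toFun := ratDerivFun
      map_add' := fun f g => by
        induction f using RatFunc.induction_on with
        | f p q hq =>
        induction g using RatFunc.induction_on with
        | f r s hs =>
        have hq' : toRat q ≠ 0 := toRat_ne_zero hq
        have hs' : toRat s ≠ 0 := toRat_ne_zero hs
        have h : toRat p / toRat q + toRat r / toRat s =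
            toRat (p * s + q * r) / toRat (q * s) := by
          rw [div_add_div _ _ hq' hs']; simp [toRat]
        rw [h, ratDerivFun_div _ _ (mul_ne_zero hq hs), ratDerivFun_div _ _ hq,
          ratDerivFun_div _ _ hs]
        simp only [toRat, derivative_mul, map_add, map_mul] at *
        field_simp
        ring
      map_smul' := fun c f => by
        induction f using RatFunc.induction_on with
        | f p q hq =>
        have h : c • (toRat p / toRat q) = toRat (c • p) / toRat q := by
          rw [toRat_smul, smul_div_assoc]
        rw [h, ratDerivFun_div _ _ hq, ratDerivFun_div _ _ hq]
        simp only [derivative_smul, toRat_smul, RingHom.id_apply, smul_mul_assoc, ← smul_sub,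
          smul_div_assoc] }
    fun f g => by
      induction f using RatFunc.induction_on with
      | f p q hq =>
      induction g using RatFunc.induction_on with
      | f r s hs =>
      have hq' : toRat q ≠ 0 := toRat_ne_zero hq
      have hs' : toRat s ≠ 0 := toRat_ne_zero hs
      have h : toRat p / toRat q * (toRat r / toRat s) =
          toRat (p * r) / toRat (q * s) := by
        rw [div_mul_div_comm]; simp [toRat]
      change ratDerivFun _ = _ • ratDerivFun _ + _ • ratDerivFun _
      rw [h, ratDerivFun_div _ _ (mul_ne_zero hq hs), ratDerivFun_div _ _ hq,
        ratDerivFun_div _ _ hs]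
      simp only [toRat, derivative_mul, map_add, map_mul, smul_eq_mul] at *
      field_simp
      ring

/-- The logarithmic derivative `f⁻¹ ∂_z f` of a rational function. -/
def dlog (f : Rat1) : Rat1 := ratDeriv f / f

/-- `∂_z` acting on the coefficients of `M(z) = ℂ(z) ⊗ M`. -/
def coeffDeriv (M : Type*) [AddCommGroup M] [Module ℂ M] : Rat1 ⊗[ℂ] M →ₗ[ℂ] Rat1 ⊗[ℂ] M :=
  (ratDeriv : Rat1 →ₗ[ℂ] Rat1).rTensor M

/-! ### Exponentials and gauge transformations -/

section Exponential

variable {L : Type*} [LieRing L] [LieAlgebra ℂ L]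

/-- The action of `exp x`, for `x ∈ L(z)`, on the vector `u ∈ V(z)`: the sum of `xⁿ u / n!`.
(It is used for locally nilpotent `x`, where the sum is finite.) -/
def expAct {V : Type*} [AddCommGroup V] [Module ℂ V] [LieRingModule L V] [LieModule ℂ L V]
    (x : Rat1 ⊗[ℂ] L) (u : Rat1 ⊗[ℂ] V) : Rat1 ⊗[ℂ] V :=
  ∑ᶠ n : ℕ, ((n.factorial : Rat1)⁻¹) •
    ((LieModule.toEnd Rat1 (Rat1 ⊗[ℂ] L) (Rat1 ⊗[ℂ] V) x) ^ n) u

/-- The gauge transformation of the connection `∂_z + A` by `g = exp x`, for an ad-nilpotent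
`x ∈ L(z)`.  The matrix of `g (∂_z + A) g⁻¹` is `g A g⁻¹ - (∂_z g) g⁻¹`, where
`g A g⁻¹ = exp (ad x) A` and `(∂_z g) g⁻¹` is the sum of `(ad x)ⁿ (∂_z x) / (n + 1)!`. -/
def gaugeExp (x A : Rat1 ⊗[ℂ] L) : Rat1 ⊗[ℂ] L :=
  expAct (V := L) x A -
    ∑ᶠ n : ℕ, (((n + 1).factorial : Rat1)⁻¹) •
      ((LieAlgebra.ad Rat1 (Rat1 ⊗[ℂ] L) x) ^ n) (coeffDeriv L x)

end Exponential

/-! ### Nondegeneracy conditions on tuples of rational functions -/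

/-- The conditions for `H`-nondegeneracy on the nonzero rational functions `y_i`, for the matrix
`a = (a_{ij})` and the polynomials `Λ_i`: the `y_i` have no multiple zeros or poles; the roots of
`Λ_i` are distinct from the zeros and poles of `y_i`; and if `i ≠ j` and `a_{ij} ≠ 0`, then the
zeros and poles of `y_i` are distinct from those of `y_j`. Zeros and poles are the roots of the
numerator and of the denominator of the reduced fraction. -/
structure HNondegCond {κ : Type*} (a : κ → κ → ℤ) (Λ : κ → ℂ[X]) (y : κ → Rat1) : Prop where
  ne_zero : ∀ i, y i ≠ 0
  simple : ∀ i w, (y i).num.rootMultiplicity w ≤ 1 ∧ (y i).denom.rootMultiplicity w ≤ 1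
  disjoint_sing : ∀ i w, (Λ i).IsRoot w → ¬ (y i).num.IsRoot w ∧ ¬ (y i).denom.IsRoot w
  disjoint : ∀ i j, i ≠ j → a i j ≠ 0 → ∀ w, ((y i).num.IsRoot w ∨ (y i).denom.IsRoot w) →
    ¬ ((y j).num.IsRoot w ∨ (y j).denom.IsRoot w)

/-- A Miura `SL(2)`-oper, given by its connection matrix `M`, is nondegenerate with respect to
the (diagonal) twist `diag(ζ, -ζ)` if it has the form
`∂_z + (ζ - y⁻¹ ∂_z y) α̌ + ρ e` with polynomials `ρ`, `y` satisfying the conditions for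
`H`-nondegeneracy. -/
def IsNondegenerateSL2 (ζ : ℂ) (M : Matrix (Fin 2) (Fin 2) Rat1) : Prop :=
  ∃ ρ y : ℂ[X],
    M = !![RatFunc.C ζ - dlog (toRat y), toRat ρ; 0, -(RatFunc.C ζ - dlog (toRat y))] ∧
    HNondegCond (fun _ _ : Unit => 2) (fun _ => ρ) (fun _ => toRat y)

/-! ### The Lie algebra data

`L` is the Lie algebra, `H` its Cartan subalgebra, and `b` a system of Chevalley generators
`b.e i = e_i`, `b.f i = f_i`, `b.h i = α̌_i`. Here `⁅α̌_j, e_i⁆ = (b.A i j) e_i`, that is,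
`b.A i j = ⟨α_i, α̌_j⟩ = a_{ji}`. The simple root `α_i ∈ H*` is `b.baseSupp i`. -/

section LieData

variable {ι L : Type*} [Fintype ι] [DecidableEq ι] [LieRing L] [LieAlgebra ℂ L]
  {H : LieSubalgebra ℂ L} (b : LieAlgebra.Basis ι H)

/-- `a_{ij} = ⟨α_j, α̌_i⟩`. -/
def cartanEntry (i j : ι) : ℤ := b.A j i

/-- `s_i(Z) = Z - ⟨α_i, Z⟩ α̌_i`. -/
def simpleReflection (i : ι) (Z : H) : H := Z - b.baseSupp i Z • b.h' i

/-- `n_+(z)`, where `n_+` is generated by the `e_i`. -/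
def nPlus : Submodule Rat1 (Rat1 ⊗[ℂ] L) :=
  (LieSubalgebra.lieSpan ℂ L (Set.range b.e)).toSubmodule.baseChange Rat1

/-- `b_+(z)`, where `b_+` is generated by the `e_i` and the `α̌_i`. -/
def bPlus : Submodule Rat1 (Rat1 ⊗[ℂ] L) :=
  (LieSubalgebra.lieSpan ℂ L (Set.range b.e ∪ Set.range b.h)).toSubmodule.baseChange Rat1

/-- `b_-(z)`, where `b_-` is generated by the `f_i` and the `α̌_i`. -/
def bMinus : Submodule Rat1 (Rat1 ⊗[ℂ] L) :=
  (LieSubalgebra.lieSpan ℂ L (Set.range b.f ∪ Set.range b.h)).toSubmodule.baseChange Rat1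

/-! ### Representations and the action of `B_+(z)` -/

section Representations

variable (V : Type*) [AddCommGroup V] [Module ℂ V] [LieRingModule L V] [LieModule ℂ L V]

/-- `V` is the irreducible finite-dimensional representation whose highest weight is the
fundamental weight `ω_i`, and `ν` is a highest weight vector. -/
structure IsFundamental (i : ι) (ν : V) : Prop where
  finite : FiniteDimensional ℂ V
  irreducible : LieModule.IsIrreducible ℂ L V
  ne_zero : ν ≠ 0
  e_act : ∀ j, ⁅b.e j, ν⁆ = 0
  h_act : ∀ j, ⁅b.h j, ν⁆ = (if j = i then (1 : ℂ) else 0) • ν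

/-- The weight space of `V(z)` on which `α̌_j` acts by the integer `m j`, for each `j`. -/
def weightSpace (m : ι → ℤ) : Submodule Rat1 (Rat1 ⊗[ℂ] V) :=
  ⨅ j, Module.End.eigenspace
    (LieModule.toEnd Rat1 (Rat1 ⊗[ℂ] L) (Rat1 ⊗[ℂ] V) (1 ⊗ₜ[ℂ] b.h j)) (m j : Rat1)

variable {V}

/-- The decomposition of a vector of `V(z)` into weight vectors is unique. -/
theorem weight_decomp_unique (c d : (ι → ℤ) →₀ Rat1 ⊗[ℂ] V)
    (hc : ∀ m, c m ∈ weightSpace b V m) (hd : ∀ m, d m ∈ weightSpace b V m)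
    (h : c.sum (fun _ w => w) = d.sum (fun _ w => w)) : c = d := by
  classical
  set T : ι → Module.End Rat1 (Rat1 ⊗[ℂ] V) := fun j =>
    LieModule.toEnd Rat1 (Rat1 ⊗[ℂ] L) (Rat1 ⊗[ℂ] V) (1 ⊗ₜ[ℂ] b.h j) with hT
  have hcomm : ∀ i j, Commute (T i) (T j) := fun i j => by
    refine LinearMap.ext fun u => ?_
    change ⁅(1 : Rat1) ⊗ₜ[ℂ] b.h i, ⁅(1 : Rat1) ⊗ₜ[ℂ] b.h j, u⁆⁆ =
      ⁅(1 : Rat1) ⊗ₜ[ℂ] b.h j, ⁅(1 : Rat1) ⊗ₜ[ℂ] b.h i, u⁆⁆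
    rw [leibniz_lie, LieAlgebra.ExtendScalars.bracket_tmul, b.lie_h_h, tmul_zero, zero_lie,
      zero_add]
  have hind := Module.End.independent_iInf_maxGenEigenspace_of_forall_mapsTo T
    (fun i j φ => Module.End.mapsTo_maxGenEigenspace_of_comm (hcomm j i) φ)
  have hinj : Function.Injective (fun (m : ι → ℤ) (j : ι) => (m j : Rat1)) := fun m m' hm => by
    funext j
    exact Int.cast_injective (α := Rat1) (congrFun hm j)
  have hind' : iSupIndep (weightSpace (L := L) b V) := (hind.comp hinj).mono fun m =>
    iInf_mono fun j => (T j).genEigenspace (m j : Rat1) |>.monotone le_top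
  rw [iSupIndep_iff_finsetSum_eq_imp_eq] at hind'
  have key := hind' (c.support ∪ d.support) c d (fun m _ => ⟨hc m, hd m⟩) (by
    rw [← Finsupp.sum_of_support_subset c Finset.subset_union_left (fun _ w => w) (by simp),
      ← Finsupp.sum_of_support_subset d Finset.subset_union_right (fun _ w => w) (by simp), h])
  ext1 m
  by_cases hm : m ∈ c.support ∪ d.support
  · exact key m hm
  · simp only [Finset.mem_union, Finsupp.mem_support_iff, not_or, not_not] at hm
    rw [hm.1, hm.2]

open Classical in
/-- The action of the element `∏ y_j^{α̌_j}` of `H(z)` on `V(z)`: it multiplies a vector of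
weight `m` by `∏ y_j^{m_j}`. (Every vector is a sum of weight vectors if `V` is
finite-dimensional; other vectors, which do not occur, are sent to `0`.) -/
def torusAct (y : ι → Rat1ˣ) (u : Rat1 ⊗[ℂ] V) : Rat1 ⊗[ℂ] V :=
  if h : ∃ c : (ι → ℤ) →₀ Rat1 ⊗[ℂ] V,
      (∀ m, c m ∈ weightSpace b V m) ∧ c.sum (fun _ w => w) = u then
    h.choose.sum (fun m w => ((∏ j, y j ^ m j : Rat1ˣ) : Rat1) • w)
  else 0

theorem torusAct_eq (y : ι → Rat1ˣ) (c : (ι → ℤ) →₀ Rat1 ⊗[ℂ] V)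
    (hc : ∀ m, c m ∈ weightSpace b V m) :
    torusAct b y (c.sum (fun _ w => w)) =
      c.sum (fun m w => ((∏ j, y j ^ m j : Rat1ˣ) : Rat1) • w) := by
  have h : ∃ d : (ι → ℤ) →₀ Rat1 ⊗[ℂ] V,
      (∀ m, d m ∈ weightSpace b V m) ∧ d.sum (fun _ w => w) = c.sum (fun _ w => w) :=
    ⟨c, hc, rfl⟩
  rw [torusAct, dif_pos h,
    weight_decomp_unique b h.choose c h.choose_spec.1 hc h.choose_spec.2]

/-- The action on `V(z)` of the element `v(z) = (∏ y_j^{α̌_j}) exp(x)` of `B_+(z)`, where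
`x ∈ n_+(z)`. Every element of `B_+(z) = H(z) N_+(z)` is of this form. -/
def borelAct (y : ι → Rat1ˣ) (x : Rat1 ⊗[ℂ] L) (u : Rat1 ⊗[ℂ] V) : Rat1 ⊗[ℂ] V :=
  torusAct b y (expAct x u)

/-- The subspace `W_i(z) ⊆ V(z)` spanned by the highest weight vector `ν` and `f_i ν`. -/
def rankTwo (i : ι) (ν : V) : Submodule Rat1 (Rat1 ⊗[ℂ] V) :=
  Submodule.span Rat1 {(1 : Rat1) ⊗ₜ[ℂ] ν, (1 : Rat1) ⊗ₜ[ℂ] ⁅b.f i, ν⁆}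

end Representations

/-! ### Miura–Plücker opers -/

/-- The connection `∂_z + A` on the trivial bundle, with its standard reductions to `B_-` and
`B_+`, is a Miura oper with regular singularities determined by the `Λ_i`:
`A = ∑ Λ_i e_i + (an element of b_-(z))`, and the connection preserves the reduction to `B_+`. -/
def IsMiuraOper (Λ : ι → ℂ[X]) (A : Rat1 ⊗[ℂ] L) : Prop :=
  A - ∑ j, toRat (Λ j) ⊗ₜ[ℂ] b.e j ∈ bMinus b ∧ A ∈ bPlus b

/-- The Miura oper `∂_z + A` is a `Z`-twisted Miura–Plücker oper: there is `v(z) ∈ B_+(z)` such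
that for all `i` the connection `∇_i` induced on `W_i ⊆ V_i` equals `v(z) (∂_z + Z) v(z)⁻¹`
restricted to `W_i`, that is, `(∂_z + A) v = v (∂_z + Z)` on `W_i(z)`. Here `V_i` is any model
of the irreducible representation with highest weight `ω_i`. -/
def IsTwistedMiuraPlucker (Λ : ι → ℂ[X]) (Z : H) (A : Rat1 ⊗[ℂ] L) : Prop :=
  IsMiuraOper b Λ A ∧
    ∃ (y : ι → Rat1ˣ) (x : Rat1 ⊗[ℂ] L), x ∈ nPlus b ∧
      ∀ (i : ι) (V : Type) [AddCommGroup V] [Module ℂ V] [LieRingModule L V] [LieModule ℂ L V]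
        (ν : V), IsFundamental b V i ν →
        ∀ w ∈ rankTwo b i ν,
          coeffDeriv V (borelAct b y x w) + ⁅A, borelAct b y x w⁆ =
            borelAct b y x (coeffDeriv V w + ⁅(1 : Rat1) ⊗ₜ[ℂ] (Z : L), w⁆)

/-- The coefficient `ρ_i = Λ_i ∏_{k ≠ i} y_k^{-a_{ki}}`. -/
def rho (Λ : ι → ℂ[X]) (y : ι → Rat1) (i : ι) : Rat1 :=
  toRat (Λ i) * ∏ k ∈ Finset.univ.erase i, y k ^ (-cartanEntry b k i)

/-- The matrix of the associated Miura `SL(2)`-oper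
`∂_z + (ζ_i - y_i⁻¹ ∂_z y_i) α̌_i + ρ_i e_i`. -/
def sl2Oper (Λ : ι → ℂ[X]) (ζ : ι → ℂ) (y : ι → Rat1) (i : ι) :
    Matrix (Fin 2) (Fin 2) Rat1 :=
  !![RatFunc.C (ζ i) - dlog (y i), rho b Λ y i; 0, -(RatFunc.C (ζ i) - dlog (y i))]

/-- `∂_z + A` is a nondegenerate `Z`-twisted Miura–Plücker oper. Its Cartan connection (the image
of `A` in `b_+ / n_+`) is `∑ (ζ_i - y_i⁻¹ ∂_z y_i) α̌_i`, where `Z = ∑ ζ_i α̌_i` and the `y_i` are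
rational functions (unique up to constants); the `y_i` satisfy the conditions for
`H`-nondegeneracy, and all the associated Miura `SL(2)`-opers are nondegenerate. -/
def IsNondegTwistedMiuraPlucker (Λ : ι → ℂ[X]) (Z : H) (A : Rat1 ⊗[ℂ] L) : Prop :=
  IsTwistedMiuraPlucker b Λ Z A ∧
    ∃ (ζ : ι → ℂ) (y : ι → Rat1), Z = ∑ j, ζ j • b.h' j ∧
      A - ∑ j, (RatFunc.C (ζ j) - dlog (y j)) ⊗ₜ[ℂ] b.h j ∈ nPlus b ∧
      HNondegCond (cartanEntry b) Λ y ∧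
      ∀ i, IsNondegenerateSL2 (ζ i) (sl2Oper b Λ ζ y i)

/-! ### The `qq`-system -/

/-- `W(p, q) = p ∂_z q - q ∂_z p`. -/
def wronskian (p q : ℂ[X]) : ℂ[X] := p * derivative q - q * derivative p

/-- The polynomials `q^i_+ = qp i`, `q^i_- = qm i` solve the `qq`-system
`W(q^i_+, q^i_-) + ⟨α_i, Z⟩ q^i_+ q^i_- = Λ_i ∏_{j ≠ i} (q^j_+)^{-a_{ji}}`. -/
def IsSolution (Λ : ι → ℂ[X]) (Z : H) (qp qm : ι → ℂ[X]) : Prop :=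
  ∀ i, wronskian (qp i) (qm i) + C (b.baseSupp i Z) * (qp i * qm i) =
    Λ i * ∏ j ∈ Finset.univ.erase i, qp j ^ (-cartanEntry b j i).toNat

/-- The nondegeneracy condition on a solution of the `qq`-system, which only involves the
`q^i_+`. -/
def IsNondegenerate (Λ : ι → ℂ[X]) (qp : ι → ℂ[X]) : Prop :=
  (∀ i, (qp i).Monic) ∧ HNondegCond (cartanEntry b) Λ (fun i => toRat (qp i))

/-- The tuple `q^1_+, …, q^{i-1}_+, q^i_-, q^{i+1}_+, …, q^r_+`. -/
def swapAt (i : ι) (qp qm : ι → ℂ[X]) : ι → ℂ[X] := Function.update qp i (qm i)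

/-- `i`-generic polynomial solutions. -/
def IsGenericSolution (Λ : ι → ℂ[X]) (Z : H) (i : ι) (qp qm : ι → ℂ[X]) : Prop :=
  IsSolution b Λ Z qp qm ∧ IsNondegenerate b Λ qp ∧
    HNondegCond (cartanEntry b) Λ (fun j => toRat (swapAt i qp qm j))

/-- `i`-composable polynomial solutions. -/
def IsComposableSolution (Λ : ι → ℂ[X]) (Z : H) (i : ι) (qp qm : ι → ℂ[X]) : Prop :=
  IsSolution b Λ Z qp qm ∧
    ∃ rm : ι → ℂ[X], IsSolution b Λ (simpleReflection b i Z) (swapAt i qp qm) rm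

/-- The matrix of the connection
`∂_z + ∑ (ζ_j - (q^j_+)⁻¹ ∂_z q^j_+) α̌_j + ∑ Λ_j e_j`, where `Z = ∑ ζ_j α̌_j`. -/
def solutionConnection (Λ : ι → ℂ[X]) (Z : H) (qp : ι → ℂ[X]) : Rat1 ⊗[ℂ] L :=
  (1 : Rat1) ⊗ₜ[ℂ] (Z : L) - ∑ j, dlog (toRat (qp j)) ⊗ₜ[ℂ] b.h j
    + ∑ j, toRat (Λ j) ⊗ₜ[ℂ] b.e j

/-- `μ_i = Λ_i⁻¹ (∂_z log (q^i_- / q^i_+) + ⟨α_i, Z⟩)`. -/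
def mu (Λ : ι → ℂ[X]) (Z : H) (i : ι) (qp qm : ι → ℂ[X]) : Rat1 :=
  (toRat (Λ i))⁻¹ * (dlog (toRat (qm i) / toRat (qp i)) + RatFunc.C (b.baseSupp i Z))

/-- The matrix of the Bäcklund-transformed connection `∇^{(i)}`: the gauge transformation of the
connection of the solution by `exp(μ_i f_i)`. -/
def backlund (Λ : ι → ℂ[X]) (Z : H) (i : ι) (qp qm : ι → ℂ[X]) : Rat1 ⊗[ℂ] L :=
  gaugeExp (mu b Λ Z i qp qm ⊗ₜ[ℂ] b.f i) (solutionConnection b Λ Z qp)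

end LieData

end MiuraPlucker

end

open Polynomial TensorProduct

noncomputable section

namespace MiuraPlucker

/-! ### Polynomial solutions of first order equations -/

/-- The operator `t ↦ t' + c t` on complex polynomials is surjective. -/
theorem exists_derivative_add_C_mul_eq (c : ℂ) (P : ℂ[X]) :
    ∃ t : ℂ[X], derivative t + C c * t = P := by
  rcases eq_or_ne c 0 with rfl | hc
  · induction P using Polynomial.induction_on' with
    | add p q hp hq =>
      obtain ⟨s, hs⟩ := hp
      obtain ⟨t, ht⟩ := hq
      exact ⟨s + t, by rw [← hs, ← ht, derivative_add]; ring⟩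
    | monomial n a =>
      refine ⟨monomial (n + 1) (a / (n + 1)), ?_⟩
      have h : (n : ℂ) + 1 ≠ 0 := Nat.cast_add_one_ne_zero n
      simp [div_mul_cancel₀ _ h]
  · suffices h : ∀ n : ℕ, ∀ P : ℂ[X], P.natDegree < n → ∃ t : ℂ[X], derivative t + C c * t = P from
      h _ P (Nat.lt_succ_self _)
    intro n
    induction n with
    | zero => intro P hP; omega
    | succ n ih =>
      intro P hP
      rcases Nat.eq_zero_or_pos P.natDegree with h0 | h0
      · refine ⟨C c⁻¹ * P, ?_⟩
        rw [derivative_C_mul, derivative_of_natDegree_zero h0, mul_zero, zero_add, ← mul_assoc,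
          ← C_mul, mul_inv_cancel₀ hc, C_1, one_mul]
      -- The first approximation $c^{-1}P$ leaves the error $c^{-1}P'$, of smaller degree.
      · obtain ⟨t, ht⟩ := ih (-(C c⁻¹ * derivative P)) (by
          rw [natDegree_neg]
          have h1 := natDegree_C_mul_le c⁻¹ (derivative P)
          have h2 := natDegree_derivative_lt h0.ne'
          omega)
        refine ⟨C c⁻¹ * P + t, ?_⟩
        have h3 : C c * C c⁻¹ = (1 : ℂ[X]) := by rw [← C_mul, mul_inv_cancel₀ hc, C_1]
        rw [derivative_add, derivative_C_mul]
        linear_combination ht + P * h3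

/-- The Bethe equations, in polynomial form, hold for the positive part of a solution. -/
theorem dvd_bethe_of_wronskian {q r F : ℂ[X]} {c : ℂ}
    (h : wronskian q r + C c * (q * r) = F) :
    q ∣ (C c * F + derivative F) * derivative q - F * derivative (derivative q) := by
  subst h
  refine ⟨(C c * (derivative r + C c * r) + derivative (derivative r) + C c * derivative r) *
    derivative q - (derivative r + C c * r) * derivative (derivative q), ?_⟩
  simp only [wronskian, derivative_add, derivative_sub, derivative_mul, derivative_C]
  ring

/-- The Bethe equations are sufficient for the existence of a polynomial solution. -/
theorem exists_wronskian_eq_of_dvd_bethe {q F : ℂ[X]} {c : ℂ} (hq : IsCoprime q (derivative q))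
    (h : q ∣ (C c * F + derivative F) * derivative q - F * derivative (derivative q)) :
    ∃ r, wronskian q r + C c * (q * r) = F := by
  obtain ⟨u, v, huv⟩ := hq
  -- Modulo $q$ the equation reads $-r q'=F$, so $r_0$ solves it modulo $q$. With $r=r_0+qt$ what
  -- remains is $q(t'+ct)=s-r_0'-c\,r_0$.
  set r₀ : ℂ[X] := -(F * v) with hr₀
  set s : ℂ[X] := F * u with hs
  have hF : F = -(r₀ * derivative q) + q * s := by linear_combination -F * huv
  -- The Bethe equations enter here; the factor $(q')^2$ is then removed by coprimality.
  have hdvd : q ∣ derivative q ^ 2 * (s - derivative r₀ - C c * r₀) := by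
    obtain ⟨w, hw⟩ := h
    refine ⟨w - C c * s * derivative q - derivative s * derivative q +
      s * derivative (derivative q), ?_⟩
    have hF' := congrArg derivative hF
    simp only [derivative_add, derivative_neg, derivative_mul] at hF'
    linear_combination hw - derivative q * hF' -
      (C c * derivative q - derivative (derivative q)) * hF
  obtain ⟨P, hP⟩ := IsCoprime.dvd_of_dvd_mul_left (IsCoprime.pow_right ⟨u, v, huv⟩) hdvd
  obtain ⟨t, ht⟩ := exists_derivative_add_C_mul_eq c P
  refine ⟨r₀ + q * t, ?_⟩
  simp only [wronskian, derivative_add, derivative_mul]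
  linear_combination q ^ 2 * ht - q * hP - hF

/-- Transfer of the Bethe equations when a factor `p ^ n` is replaced by `m ^ n`. -/
theorem dvd_bethe_transfer {q G p m : ℂ[X]} {c ζ : ℂ} {n : ℕ} (hp : IsCoprime q p)
    (h : q ∣ (C c * (G * p ^ n) + derivative (G * p ^ n)) * derivative q -
      (G * p ^ n) * derivative (derivative q))
    (hE : n = 0 ∨ q ∣ wronskian p m + C ζ * (p * m)) :
    q ∣ (C (c + n * ζ) * (G * m ^ n) + derivative (G * m ^ n)) * derivative q -
      (G * m ^ n) * derivative (derivative q) := by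
  rcases n with _ | n
  · simpa using h
  · replace hE := hE.resolve_left (Nat.succ_ne_zero n)
    -- Multiplying by a power of $p$, a unit modulo $q$, clears the denominators in the comparison
    -- of the two logarithmic derivatives.
    refine IsCoprime.dvd_of_dvd_mul_left (hp.pow_right (n := n + 2)) ?_
    obtain ⟨A, hA⟩ := h
    obtain ⟨B, hB⟩ := hE
    refine ⟨m ^ (n + 1) * p * A + (n + 1 : ℂ[X]) * G * p ^ (n + 1) * m ^ n * derivative q * B, ?_⟩
    simp only [wronskian, derivative_mul, derivative_pow, C_add, C_mul, Nat.add_sub_cancel,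
      Nat.cast_add, Nat.cast_one, C_1, map_natCast] at hA hB ⊢
    linear_combination m ^ (n + 1) * p * hA +
      (n + 1 : ℂ[X]) * G * p ^ (n + 1) * m ^ n * derivative q * hB

/-- A nonzero polynomial without multiple roots is coprime to its derivative. -/
theorem isCoprime_derivative_of_rootMultiplicity_le_one {q : ℂ[X]} (hq : q ≠ 0)
    (h : ∀ w, q.rootMultiplicity w ≤ 1) : IsCoprime q (derivative q) := by
  refine (Polynomial.separable_def q).mp ?_
  rw [← nodup_roots_iff_of_splits hq (IsAlgClosed.splits q)]
  rw [Multiset.nodup_iff_count_le_one]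
  intro w
  rw [count_roots]
  exact h w

/-- Polynomials over `ℂ` without common roots are coprime. -/
theorem isCoprime_of_forall_not_isRoot {p q : ℂ[X]} (h : ∀ w, p.IsRoot w → ¬ q.IsRoot w) :
    IsCoprime p q := by
  refine (Polynomial.isCoprime_iff_aeval_ne_zero_of_isAlgClosed (k := ℂ) ℂ p q).mpr fun w => ?_
  by_contra! hw
  simp only [coe_aeval_eq_eval] at hw
  exact h w hw.1 hw.2

/-! ### The Cartan matrix -/

section Cartan

variable {ι L : Type*} [Fintype ι] [LieRing L] [LieAlgebra ℂ L]
  {H : LieSubalgebra ℂ L} (b : LieAlgebra.Basis ι H)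

theorem A_self (i : ι) : b.A i i = 2 := by
  have : IsAddTorsionFree L := .of_isTorsionFree ℂ L
  exact b.A_diag_eq_two i

/-- $e_i$ is killed by $f_j$, so it is a highest weight vector of weight
$-\langle\alpha_i,\check\alpha_j\rangle$ for the opposite $\mathfrak{sl}_2$-triple at $j$; in finite
dimension such a weight is a natural number. -/
theorem A_nonpos [FiniteDimensional ℂ L] {i j : ι} (hij : i ≠ j) : b.A i j ≤ 0 := by
  have hP : (b.sl2 j).symm.HasPrimitiveVectorWith (b.e i) (-(b.A i j : ℂ)) :=
    { ne_zero := (b.sl2 i).e_ne_zero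
      lie_h := by rw [neg_lie, b.lie_h_e, neg_smul, Int.cast_smul_eq_zsmul]
      lie_e := by rw [← lie_skew, b.lie_e_f_ne i j hij, neg_zero] }
  obtain ⟨n, hn⟩ := hP.exists_nat
  have : -(b.A i j) = n := by exact_mod_cast hn
  omega

/-- A vanishing entry makes $e_i$ primitive of weight $0$ for the opposite triple at $j$, so
$[e_j,e_i]=0$. Bracketing with $f_i$ returns the transposed entry times $e_j$. -/
theorem A_eq_zero_symm [FiniteDimensional ℂ L] {i j : ι} (h : b.A i j = 0) : b.A j i = 0 := by
  have hij : i ≠ j := by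
    rintro rfl
    rw [A_self] at h
    exact absurd h (by norm_num)
  have hP : (b.sl2 j).symm.HasPrimitiveVectorWith (b.e i) (0 : ℂ) :=
    { ne_zero := (b.sl2 i).e_ne_zero
      lie_h := by rw [neg_lie, b.lie_h_e, h, zero_smul, zero_smul, neg_zero]
      lie_e := by rw [← lie_skew, b.lie_e_f_ne i j hij, neg_zero] }
  have h0 : ⁅b.e j, b.e i⁆ = 0 := by
    have := hP.pow_toEnd_f_eq_zero_of_eq_nat (n := 0) (by simp)
    simpa using this
  have h1 : ⁅b.f i, ⁅b.e j, b.e i⁆⁆ = b.A j i • b.e j := by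
    rw [leibniz_lie, ← lie_skew (b.f i) (b.e j), b.lie_e_f_ne j i hij.symm, neg_zero, zero_lie,
      zero_add, ← lie_skew (b.f i), (b.sl2 i).lie_e_f, lie_neg, lie_skew, b.lie_h_e]
  rw [h0, lie_zero, eq_comm, ← Int.cast_smul_eq_zsmul ℂ] at h1
  simpa [(b.sl2 j).e_ne_zero] using h1

end Cartan

/-! ### Logarithmic derivatives -/

theorem ratDeriv_toRat (p : ℂ[X]) : ratDeriv (toRat p) = toRat (derivative p) := by
  have h := ratDerivFun_div p 1 one_ne_zero
  simp only [toRat, map_one, div_one, mul_one, derivative_one, map_zero, mul_zero, sub_zero,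
    one_pow] at h
  exact h

theorem ratDeriv_mul (f g : Rat1) : ratDeriv (f * g) = f * ratDeriv g + g * ratDeriv f := by
  simp [Derivation.leibniz]

theorem dlog_mul {f g : Rat1} (hf : f ≠ 0) (hg : g ≠ 0) : dlog (f * g) = dlog f + dlog g := by
  simp only [dlog, ratDeriv_mul]
  field_simp
  ring

theorem dlog_one : dlog 1 = 0 := by simp [dlog]

theorem dlog_inv {f : Rat1} (hf : f ≠ 0) : dlog f⁻¹ = -dlog f := by
  have h := dlog_mul hf (inv_ne_zero hf)
  rw [mul_inv_cancel₀ hf, dlog_one] at h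
  linear_combination -h

theorem dlog_div {f g : Rat1} (hf : f ≠ 0) (hg : g ≠ 0) : dlog (f / g) = dlog f - dlog g := by
  rw [div_eq_mul_inv, dlog_mul hf (inv_ne_zero hg), dlog_inv hg, sub_eq_add_neg]

theorem dlog_pow {f : Rat1} (hf : f ≠ 0) (n : ℕ) : dlog (f ^ n) = n * dlog f := by
  induction n with
  | zero => simp [dlog_one]
  | succ n ih =>
    rw [pow_succ, dlog_mul (pow_ne_zero n hf) hf, ih]
    push_cast
    ring

theorem dlog_zpow {f : Rat1} (hf : f ≠ 0) (n : ℤ) : dlog (f ^ n) = n * dlog f := by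
  obtain ⟨n, rfl | rfl⟩ := n.eq_nat_or_neg
  · rw [zpow_natCast, dlog_pow hf, Int.cast_natCast]
  · rw [zpow_neg, zpow_natCast, dlog_inv (pow_ne_zero n hf), dlog_pow hf]
    push_cast
    ring

theorem dlog_prod {κ : Type*} (s : Finset κ) (f : κ → Rat1) (hf : ∀ k ∈ s, f k ≠ 0) :
    dlog (∏ k ∈ s, f k) = ∑ k ∈ s, dlog (f k) := by
  classical
  induction s using Finset.induction_on with
  | empty => simp [dlog_one]
  | insert a s ha ih =>
    have hs : ∀ k ∈ s, f k ≠ 0 := fun k hk => hf k (Finset.mem_insert_of_mem hk)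
    rw [Finset.prod_insert ha, Finset.sum_insert ha,
      dlog_mul (hf a (Finset.mem_insert_self a s)) (Finset.prod_ne_zero_iff.mpr hs), ih hs]

theorem ratDeriv_eq_mul_dlog {f : Rat1} (hf : f ≠ 0) : ratDeriv f = f * dlog f := by
  rw [dlog, mul_div_cancel₀ _ hf]

theorem dlog_toRat_C_mul {c : ℂ} (hc : c ≠ 0) {p : ℂ[X]} (hp : p ≠ 0) :
    dlog (toRat (C c * p)) = dlog (toRat p) := by
  have h : toRat (C c) ≠ 0 := toRat_ne_zero (C_ne_zero.mpr hc)
  rw [toRat, map_mul, dlog_mul h (toRat_ne_zero hp), dlog, ratDeriv_toRat]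
  simp [toRat]

/-- Compare the coefficients of $z^{\deg p+\deg q-1}$: they are the product of the leading
coefficients times $\deg p$ and $\deg q$ respectively. -/
theorem natDegree_eq_of_derivative_mul_comm {p q : ℂ[X]} (hp : p ≠ 0) (hq : q ≠ 0)
    (h : derivative p * q = derivative q * p) : p.natDegree = q.natDegree := by
  rcases Nat.eq_zero_or_pos p.natDegree with hp0 | hp0
  · rw [derivative_of_natDegree_zero hp0, zero_mul, eq_comm, mul_eq_zero, or_iff_left hp] at h
    rw [hp0, derivative_eq_zero.mp h]
  rcases Nat.eq_zero_or_pos q.natDegree with hq0 | hq0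
  · rw [derivative_of_natDegree_zero hq0, zero_mul, mul_eq_zero, or_iff_left hq] at h
    rw [hq0, derivative_eq_zero.mp h]
  have key : ∀ r s : ℂ[X], 0 < r.natDegree →
      (derivative r * s).coeff (r.natDegree - 1 + s.natDegree) =
        r.leadingCoeff * r.natDegree * s.leadingCoeff := by
    intro r s hr
    rw [coeff_mul_add_eq_of_natDegree_le (natDegree_derivative_le r) le_rfl, coeff_derivative,
      Nat.sub_add_cancel hr]
    have : ((r.natDegree - 1 : ℕ) : ℂ) + 1 = r.natDegree := by
      exact_mod_cast congrArg (Nat.cast (R := ℂ)) (Nat.sub_add_cancel hr)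
    rw [this]
    rfl
  have h1 := key p q hp0
  have h2 := key q p hq0
  rw [h, show p.natDegree - 1 + q.natDegree = q.natDegree - 1 + p.natDegree by omega, h2] at h1
  have hp' := leadingCoeff_ne_zero.mpr hp
  have hq' := leadingCoeff_ne_zero.mpr hq
  have h3 : (q.leadingCoeff * p.leadingCoeff) * ((q.natDegree : ℂ) - p.natDegree) = 0 := by
    linear_combination h1
  have h4 := (mul_eq_zero.mp h3).resolve_left (mul_ne_zero hq' hp')
  exact_mod_cast (sub_eq_zero.mp h4).symm

/-- The relation is linear in $p$, so it passes to $p-q$. If nonzero, $p-q$ would have the degree of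
$q$, but the leading terms cancel. -/
theorem eq_of_derivative_mul_comm_of_monic {p q : ℂ[X]} (hp : p.Monic) (hq : q.Monic)
    (h : derivative p * q = derivative q * p) : p = q := by
  by_contra hne
  have hd : p - q ≠ 0 := sub_ne_zero.mpr hne
  have hdeg := natDegree_eq_of_derivative_mul_comm hp.ne_zero hq.ne_zero h
  have h1 : (p - q).natDegree = q.natDegree := natDegree_eq_of_derivative_mul_comm hd hq.ne_zero (by
    rw [derivative_sub]
    linear_combination h)
  have h2 : (p - q).degree < p.degree := degree_sub_lt_left
    (by rw [degree_eq_natDegree hp.ne_zero, degree_eq_natDegree hq.ne_zero, hdeg]) hp.ne_zero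
    (by rw [hp.leadingCoeff, hq.leadingCoeff])
  have h3 := natDegree_lt_natDegree hd h2
  omega

/-- Monic polynomials are determined by their logarithmic derivatives. -/
theorem eq_of_dlog_eq_of_monic {p q : ℂ[X]} (hp : p.Monic) (hq : q.Monic)
    (h : dlog (toRat p) = dlog (toRat q)) : p = q := by
  refine eq_of_derivative_mul_comm_of_monic hp hq (IsFractionRing.injective ℂ[X] Rat1 ?_)
  rw [dlog, dlog, ratDeriv_toRat, ratDeriv_toRat,
    div_eq_div_iff (toRat_ne_zero hp.ne_zero) (toRat_ne_zero hq.ne_zero)] at h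
  simpa [toRat] using h

/-! ### Nondegeneracy for tuples of polynomials -/

/-- The reduced denominator of a polynomial is $1$, so only the conditions on zeros remain. -/
theorem hNondegCond_toRat_iff {κ : Type*} (a : κ → κ → ℤ) (Λ q : κ → ℂ[X]) :
    HNondegCond a Λ (fun i => toRat (q i)) ↔
      (∀ i, q i ≠ 0) ∧ (∀ i w, (q i).rootMultiplicity w ≤ 1) ∧
      (∀ i w, (Λ i).IsRoot w → ¬ (q i).IsRoot w) ∧
      ∀ i j, i ≠ j → a i j ≠ 0 → ∀ w, (q i).IsRoot w → ¬ (q j).IsRoot w := by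
  have hnum : ∀ i, (toRat (q i)).num = q i := fun i => RatFunc.num_algebraMap _
  have hden : ∀ i, (toRat (q i)).denom = 1 := fun i => RatFunc.denom_algebraMap _
  have hone : ∀ w : ℂ, ¬ (1 : ℂ[X]).IsRoot w := fun w => by simp
  have hmul : ∀ w : ℂ, (1 : ℂ[X]).rootMultiplicity w = 0 := fun w =>
    rootMultiplicity_eq_zero (hone w)
  constructor
  · rintro ⟨h1, h2, h3, h4⟩
    simp only [hnum, hden, hone, hmul, or_false] at h2 h3 h4
    exact ⟨fun i hi => h1 i (by simp [hi, toRat]), fun i w => (h2 i w).1, fun i w h => (h3 i w h).1,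
      h4⟩
  · rintro ⟨h1, h2, h3, h4⟩
    refine ⟨fun i => toRat_ne_zero (h1 i), fun i w => ?_, fun i w h => ?_, fun i j hij ha w => ?_⟩
    · simpa only [hnum, hden, hmul, zero_le, and_true] using h2 i w
    · simpa only [hnum, hden, hone, not_false_eq_true, and_true] using h3 i w h
    · simpa only [hnum, hden, hone, or_false] using h4 i j hij ha w

/-! ### Composability -/

theorem swapAt_self {ι : Type*} [DecidableEq ι] (i : ι) (p q : ι → ℂ[X]) :
    swapAt i p q i = q i :=
  Function.update_self ..

theorem swapAt_of_ne {ι : Type*} [DecidableEq ι] {i j : ι} (h : j ≠ i) (p q : ι → ℂ[X]) :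
    swapAt i p q j = p j :=
  Function.update_of_ne h ..

section Composable

variable {ι L : Type*} [Fintype ι] [LieRing L] [LieAlgebra ℂ L]
  {H : LieSubalgebra ℂ L} (b : LieAlgebra.Basis ι H)

theorem baseSupp_simpleReflection (i j : ι) (Z : H) :
    b.baseSupp j (simpleReflection b i Z) = b.baseSupp j Z - b.baseSupp i Z * b.A j i := by
  simp [simpleReflection]

theorem baseSupp_simpleReflection_self (i : ι) (Z : H) :
    b.baseSupp i (simpleReflection b i Z) = -b.baseSupp i Z := by
  rw [baseSupp_simpleReflection, A_self]
  push_cast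
  ring

variable [DecidableEq ι]

theorem isRoot_rhs {Λ q : ι → ℂ[X]} {j : ι} {w : ℂ}
    (h : (Λ j * ∏ k ∈ Finset.univ.erase j, q k ^ (-cartanEntry b k j).toNat).IsRoot w) :
    (Λ j).IsRoot w ∨ ∃ k, k ≠ j ∧ cartanEntry b k j ≠ 0 ∧ (q k).IsRoot w := by
  rw [root_mul] at h
  refine h.imp_right fun h => ?_
  rw [IsRoot, eval_prod, Finset.prod_eq_zero_iff] at h
  obtain ⟨k, hk, h⟩ := h
  rw [eval_pow] at h
  refine ⟨k, Finset.ne_of_mem_erase hk, fun h0 => ?_, eq_zero_of_pow_eq_zero h⟩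
  simp [h0] at h

/-- Every `i`-generic solution can be continued to a solution for `s_i(Z)`. -/
theorem exists_solution_swapAt [FiniteDimensional ℂ L] {Λ : ι → ℂ[X]} {Z : H} {i : ι}
    {qp qm : ι → ℂ[X]} (hq : IsGenericSolution b Λ Z i qp qm) :
    ∃ rm : ι → ℂ[X], IsSolution b Λ (simpleReflection b i Z) (swapAt i qp qm) rm ∧
      rm i = -qp i := by
  obtain ⟨hsol, ⟨-, hnd⟩, hnd'⟩ := hq
  obtain ⟨h1, h2, -, h4⟩ := (hNondegCond_toRat_iff _ _ _).mp hnd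
  obtain ⟨-, -, -, h4'⟩ := (hNondegCond_toRat_iff _ _ _).mp hnd'
  have key : ∀ j, j ≠ i → ∃ r, wronskian (qp j) r +
      C (b.baseSupp j (simpleReflection b i Z)) * (qp j * r) =
      Λ j * ∏ k ∈ Finset.univ.erase j, swapAt i qp qm k ^ (-cartanEntry b k j).toNat := by
    intro j hj
    have hi : i ∈ Finset.univ.erase j := Finset.mem_erase.mpr ⟨hj.symm, Finset.mem_univ i⟩
    set n := (-cartanEntry b i j).toNat with hn
    -- `G` collects the factors of the $j$-th right-hand side that the swap leaves alone.
    set G := Λ j * ∏ k ∈ (Finset.univ.erase j).erase i, qp k ^ (-cartanEntry b k j).toNat with hG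
    have e1 : Λ j * ∏ k ∈ Finset.univ.erase j, qp k ^ (-cartanEntry b k j).toNat =
        G * qp i ^ n := by
      rw [← Finset.prod_erase_mul _ _ hi, mul_assoc]
    have e2 : Λ j * ∏ k ∈ Finset.univ.erase j, swapAt i qp qm k ^ (-cartanEntry b k j).toNat =
        G * qm i ^ n := by
      rw [← Finset.prod_erase_mul _ _ hi, swapAt_self, ← mul_assoc, hG]
      congr 2
      refine Finset.prod_congr rfl fun k hk => ?_
      rw [swapAt_of_ne (Finset.ne_of_mem_erase hk)]
    have hA : b.A j i ≤ 0 := A_nonpos b hj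
    have hnA : (n : ℤ) = -b.A j i := Int.toNat_of_nonneg (by simpa [cartanEntry] using hA)
    have hc : b.baseSupp j (simpleReflection b i Z) =
        b.baseSupp j Z + n * b.baseSupp i Z := by
      rw [baseSupp_simpleReflection]
      have : (n : ℂ) = -(b.A j i : ℂ) := by exact_mod_cast congrArg (Int.cast (R := ℂ)) hnA
      rw [this]
      ring
    rw [e2, hc]
    have hj' := hsol j
    rw [e1] at hj'
    refine exists_wronskian_eq_of_dvd_bethe
      (isCoprime_derivative_of_rootMultiplicity_le_one (h1 j) (h2 j)) ?_
    rcases Nat.eq_zero_or_pos n with hn0 | hn0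
    · simpa [hn0] using dvd_bethe_of_wronskian hj'
    have hAji : b.A j i ≠ 0 := by omega
    refine dvd_bethe_transfer (p := qp i) ?_ (dvd_bethe_of_wronskian hj') (Or.inr ?_)
    · exact isCoprime_of_forall_not_isRoot
        (h4 j i hj fun h => hAji (A_eq_zero_symm b h))
    -- The $i$-th right-hand side contains $q^j_+$ to the power $-a_{ji}$, which is positive because
    -- $a_{ij}\ne0$ forces $a_{ji}\ne0$.
    · rw [hsol i]
      have hmem : j ∈ Finset.univ.erase i := Finset.mem_erase.mpr ⟨hj, Finset.mem_univ j⟩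
      refine Dvd.dvd.mul_left ((dvd_pow_self (qp j) ?_).trans
        (Finset.dvd_prod_of_mem (fun k => qp k ^ (-cartanEntry b k i).toNat) hmem)) _
      have := A_nonpos b hj.symm
      have : b.A i j ≠ 0 := fun h => hAji (A_eq_zero_symm b h)
      simp only [cartanEntry]
      omega
  choose! r hr using key
  refine ⟨Function.update r i (-qp i), fun j => ?_, Function.update_self ..⟩
  rcases eq_or_ne j i with rfl | hj
  · have e : ∏ k ∈ Finset.univ.erase j, swapAt j qp qm k ^ (-cartanEntry b k j).toNat =
        ∏ k ∈ Finset.univ.erase j, qp k ^ (-cartanEntry b k j).toNat :=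
      Finset.prod_congr rfl fun k hk => by rw [swapAt_of_ne (Finset.ne_of_mem_erase hk)]
    rw [e, ← hsol j, swapAt_self, Function.update_self, baseSupp_simpleReflection_self]
    simp only [wronskian, derivative_neg, C_neg]
    ring
  · rw [Function.update_of_ne hj, swapAt_of_ne hj]
    exact hr j hj

/-- Rescaling the positive part of a solution. -/
theorem IsSolution.rescale {Λ : ι → ℂ[X]} {Z : H} {qp qm : ι → ℂ[X]}
    (h : IsSolution b Λ Z qp qm) (c d : ι → ℂ)
    (hd : ∀ j, c j * d j = ∏ k ∈ Finset.univ.erase j, c k ^ (-cartanEntry b k j).toNat) :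
    IsSolution b Λ Z (fun j => C (c j) * qp j) (fun j => C (d j) * qm j) := by
  intro j
  -- By `hd` the right side scales by $c_jd_j$, as the bilinear left side does.
  have e : ∏ k ∈ Finset.univ.erase j, (C (c k) * qp k) ^ (-cartanEntry b k j).toNat =
      C (c j) * C (d j) * ∏ k ∈ Finset.univ.erase j, qp k ^ (-cartanEntry b k j).toNat := by
    simp only [mul_pow, Finset.prod_mul_distrib, ← C_pow, ← C_mul, hd j, ← map_prod]
  have := h j
  simp only [e]
  simp only [wronskian, derivative_C_mul] at this ⊢
  linear_combination (C (c j) * C (d j)) * this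

end Composable

/-! ### Gauge transformations -/

theorem coeffDeriv_tmul {M : Type*} [AddCommGroup M] [Module ℂ M] (r : Rat1) (m : M) :
    coeffDeriv M (r ⊗ₜ[ℂ] m) = ratDeriv r ⊗ₜ[ℂ] m := rfl

theorem tmul_smul_eq {V : Type*} [AddCommGroup V] [Module ℂ V] (c : ℂ) (r : Rat1) (v : V) :
    r ⊗ₜ[ℂ] (c • v) = (r * RatFunc.C c) ⊗ₜ[ℂ] v := by
  rw [← smul_tmul, Algebra.smul_def, mul_comm]
  rfl

theorem expAct_eq_sum {L V : Type*} [LieRing L] [LieAlgebra ℂ L] [AddCommGroup V] [Module ℂ V]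
    [LieRingModule L V] [LieModule ℂ L V] {x : Rat1 ⊗[ℂ] L} {u : Rat1 ⊗[ℂ] V} {N : ℕ}
    (h : ((LieModule.toEnd Rat1 (Rat1 ⊗[ℂ] L) (Rat1 ⊗[ℂ] V) x) ^ N) u = 0) :
    expAct x u = ∑ n ∈ Finset.range N, ((n.factorial : Rat1)⁻¹) •
      ((LieModule.toEnd Rat1 (Rat1 ⊗[ℂ] L) (Rat1 ⊗[ℂ] V) x) ^ n) u := by
  refine finsum_eq_sum_of_support_subset _ fun n hn => ?_
  by_contra hN
  simp only [Finset.coe_range, Set.mem_Iio, not_lt] at hN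
  refine hn ?_
  beta_reduce
  rw [← Nat.sub_add_cancel hN, pow_add, Module.End.mul_apply, h, map_zero, smul_zero]

/-- Order two covers both exponentials needed: $f_i$ acts by $e_i\to\check\alpha_i\to f_i\to0$, and
$\sum_j g_je_j$ squares to zero on $W_i$. -/
theorem expAct_eq_of_lie_lie_lie_eq_zero {L V : Type*} [LieRing L] [LieAlgebra ℂ L]
    [AddCommGroup V] [Module ℂ V] [LieRingModule L V] [LieModule ℂ L V] {x : Rat1 ⊗[ℂ] L}
    {u : Rat1 ⊗[ℂ] V} (h : ⁅x, ⁅x, ⁅x, u⁆⁆⁆ = 0) :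
    expAct x u = u + ⁅x, u⁆ + (2 : Rat1)⁻¹ • ⁅x, ⁅x, u⁆⁆ := by
  have h3 : ((LieModule.toEnd Rat1 (Rat1 ⊗[ℂ] L) (Rat1 ⊗[ℂ] V) x) ^ 3) u = 0 := by
    simpa only [pow_succ, pow_zero, one_mul, Module.End.mul_apply, LieModule.toEnd_apply_apply]
      using h
  rw [expAct_eq_sum h3, Finset.sum_range_succ, Finset.sum_range_succ, Finset.sum_range_one,
    pow_zero, pow_one, pow_two, Module.End.mul_apply, Module.End.one_apply,
    LieModule.toEnd_apply_apply, LieModule.toEnd_apply_apply, Nat.factorial_zero,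
    Nat.factorial_one, Nat.factorial_two, Nat.cast_one, inv_one, one_smul, one_smul, Nat.cast_ofNat]

section Backlund

variable {ι L : Type*} [Fintype ι] [LieRing L] [LieAlgebra ℂ L]
  {H : LieSubalgebra ℂ L} (b : LieAlgebra.Basis ι H)

theorem lie_f_cartan (i : ι) (Z : H) : ⁅b.f i, (Z : L)⁆ = b.baseSupp i Z • b.f i := by
  rw [b.baseSupp_apply_smul_f, ← lie_skew]
  rfl

theorem lie_f_h (i j : ι) : ⁅b.f i, b.h j⁆ = (b.A i j : ℂ) • b.f i := by
  rw [← lie_skew, b.lie_h_f, neg_smul, neg_neg, Int.cast_smul_eq_zsmul]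

theorem lie_f_e [DecidableEq ι] (i j : ι) : ⁅b.f i, b.e j⁆ = if j = i then -b.h i else 0 := by
  rw [← lie_skew]
  split_ifs with h
  · rw [h, (b.sl2 i).lie_e_f]
  · rw [b.lie_e_f_ne j i h, neg_zero]

/-- The gauge transformation by `exp(μ f_i)` of a connection with values in
`h + ∑ ℂ(z) e_j`. -/
theorem gaugeExp_f [DecidableEq ι] (i : ι) (μ : Rat1) (Z : H) (g l : ι → Rat1) :
    gaugeExp (μ ⊗ₜ[ℂ] b.f i) ((1 : Rat1) ⊗ₜ[ℂ] (Z : L) - ∑ j, g j ⊗ₜ[ℂ] b.h j +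
      ∑ j, l j ⊗ₜ[ℂ] b.e j) =
    (1 : Rat1) ⊗ₜ[ℂ] (Z : L) - ∑ j, g j ⊗ₜ[ℂ] b.h j + ∑ j, l j ⊗ₜ[ℂ] b.e j -
      (μ * l i) ⊗ₜ[ℂ] b.h i +
      (μ * (RatFunc.C (b.baseSupp i Z) - ∑ j, g j * (b.A i j : Rat1)) - μ ^ 2 * l i -
        ratDeriv μ) ⊗ₜ[ℂ] b.f i := by
  set x : Rat1 ⊗[ℂ] L := μ ⊗ₜ[ℂ] b.f i with hx
  set A : Rat1 ⊗[ℂ] L := (1 : Rat1) ⊗ₜ[ℂ] (Z : L) - ∑ j, g j ⊗ₜ[ℂ] b.h j +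
      ∑ j, l j ⊗ₜ[ℂ] b.e j with hA
  have hf : ∀ r : Rat1, ⁅x, r ⊗ₜ[ℂ] b.f i⁆ = 0 := fun r => by
    rw [hx, LieAlgebra.ExtendScalars.bracket_tmul, lie_self, tmul_zero]
  have hh : ∀ (r : Rat1) (j : ι), ⁅x, r ⊗ₜ[ℂ] b.h j⁆ = (μ * r * (b.A i j : Rat1)) ⊗ₜ[ℂ] b.f i := by
    intro r j
    rw [hx, LieAlgebra.ExtendScalars.bracket_tmul, lie_f_h, tmul_smul_eq, map_intCast]
  have h1 : ⁅x, A⁆ = (μ * (RatFunc.C (b.baseSupp i Z) - ∑ j, g j * (b.A i j : Rat1))) ⊗ₜ[ℂ] b.f i -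
      (μ * l i) ⊗ₜ[ℂ] b.h i := by
    have e1 : ⁅x, (1 : Rat1) ⊗ₜ[ℂ] (Z : L)⁆ = (μ * RatFunc.C (b.baseSupp i Z)) ⊗ₜ[ℂ] b.f i := by
      rw [hx, LieAlgebra.ExtendScalars.bracket_tmul, lie_f_cartan, tmul_smul_eq, mul_one]
    have e2 : ⁅x, ∑ j, g j ⊗ₜ[ℂ] b.h j⁆ = (μ * ∑ j, g j * (b.A i j : Rat1)) ⊗ₜ[ℂ] b.f i := by
      rw [lie_sum, Finset.mul_sum, sum_tmul]
      exact Finset.sum_congr rfl fun j _ => by rw [hh, mul_assoc]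
    have e3 : ⁅x, ∑ j, l j ⊗ₜ[ℂ] b.e j⁆ = -((μ * l i) ⊗ₜ[ℂ] b.h i) := by
      rw [lie_sum, Finset.sum_eq_single i]
      · rw [hx, LieAlgebra.ExtendScalars.bracket_tmul, lie_f_e, if_pos rfl, tmul_neg]
      · intro j _ hj
        rw [hx, LieAlgebra.ExtendScalars.bracket_tmul, lie_f_e, if_neg hj, tmul_zero]
      · simp
    rw [hA, lie_add, lie_sub, e1, e2, e3, mul_sub, sub_tmul, ← sub_eq_add_neg]
  have h2 : ⁅x, ⁅x, A⁆⁆ = -((2 * (μ ^ 2 * l i)) ⊗ₜ[ℂ] b.f i) := by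
    rw [h1, lie_sub, hf, hh, A_self, zero_sub]
    congr 2
    push_cast
    ring
  have h3 : ⁅x, ⁅x, ⁅x, A⁆⁆⁆ = 0 := by rw [h2, lie_neg, hf, neg_zero]
  have hexp : expAct (V := L) x A = A + ⁅x, A⁆ + (2 : Rat1)⁻¹ • ⁅x, ⁅x, A⁆⁆ :=
    expAct_eq_of_lie_lie_lie_eq_zero h3
  -- $\partial_z x$ is a multiple of $f_i$ and commutes with $x$, so only the term $n=0$ survives.
  have hder : ∑ᶠ n : ℕ, (((n + 1).factorial : Rat1)⁻¹) •
      ((LieAlgebra.ad Rat1 (Rat1 ⊗[ℂ] L) x) ^ n) (coeffDeriv L x) = ratDeriv μ ⊗ₜ[ℂ] b.f i := by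
    rw [finsum_eq_single _ 0]
    · simp [hx, coeffDeriv_tmul]
    · intro n hn
      obtain ⟨m, rfl⟩ := Nat.exists_eq_succ_of_ne_zero hn
      have h0 : LieAlgebra.ad Rat1 (Rat1 ⊗[ℂ] L) x (coeffDeriv L x) = 0 := hf (ratDeriv μ)
      rw [Nat.succ_eq_add_one, pow_succ, Module.End.mul_apply, h0, map_zero, smul_zero]
  rw [gaugeExp, hexp, hder, h2, h1, smul_neg, smul_tmul', smul_eq_mul,
    inv_mul_cancel_left₀ two_ne_zero, sub_tmul, sub_tmul]
  abel

variable [DecidableEq ι]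

/-- Off-diagonal Cartan entries are nonpositive, so `toNat` truncates nothing. -/
theorem toRat_rhs [FiniteDimensional ℂ L] (Λ q : ι → ℂ[X]) (i : ι) :
    toRat (Λ i * ∏ k ∈ Finset.univ.erase i, q k ^ (-cartanEntry b k i).toNat) =
      rho b Λ (fun k => toRat (q k)) i := by
  rw [rho, toRat, map_mul, map_prod]
  congr 1
  refine Finset.prod_congr rfl fun k hk => ?_
  have hA : b.A i k ≤ 0 := A_nonpos b (Finset.ne_of_mem_erase hk).symm
  rw [map_pow, ← zpow_natCast, Int.toNat_of_nonneg (by simpa [cartanEntry] using hA)]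

/-- The `qq`-system in terms of rational functions: the quotient of `q_-` by `q_+` solves a
first order equation. -/
theorem IsSolution.ratDeriv_div [FiniteDimensional ℂ L] {Λ : ι → ℂ[X]} {Z : H} {qp qm : ι → ℂ[X]}
    (h : IsSolution b Λ Z qp qm) {i : ι} (hp : qp i ≠ 0) :
    ratDeriv (toRat (qm i) / toRat (qp i)) +
      RatFunc.C (b.baseSupp i Z) * (toRat (qm i) / toRat (qp i)) =
      rho b Λ (fun k => toRat (qp k)) i / toRat (qp i) ^ 2 := by
  have hp' := toRat_ne_zero hp
  rw [← toRat_rhs, ← h i]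
  change ratDerivFun _ + _ = _
  rw [ratDerivFun_div _ _ hp]
  simp only [wronskian, toRat, map_add, map_sub, map_mul, RatFunc.algebraMap_C] at hp' ⊢
  field_simp

/-- The Bäcklund transformation replaces `Z` by `s_i(Z)` and `q^i_+` by `q^i_-`. -/
theorem solutionConnection_swapAt [FiniteDimensional ℂ L] {Λ : ι → ℂ[X]} (hΛ : ∀ j, Λ j ≠ 0)
    {Z : H} {i : ι} {qp qm : ι → ℂ[X]} (h : IsSolution b Λ Z qp qm) (hp : ∀ j, qp j ≠ 0)
    (hm : qm i ≠ 0) :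
    solutionConnection b Λ (simpleReflection b i Z) (swapAt i qp qm) = backlund b Λ Z i qp qm := by
  have hp' : ∀ j, toRat (qp j) ≠ 0 := fun j => toRat_ne_zero (hp j)
  have hm' : toRat (qm i) ≠ 0 := toRat_ne_zero hm
  have hΛ' : toRat (Λ i) ≠ 0 := toRat_ne_zero (hΛ i)
  set P : Rat1 := ∏ k ∈ Finset.univ.erase i, toRat (qp k) ^ (-cartanEntry b k i) with hP
  have hP' : P ≠ 0 := Finset.prod_ne_zero_iff.mpr fun k _ => zpow_ne_zero _ (hp' k)
  set ζ : Rat1 := RatFunc.C (b.baseSupp i Z) with hζ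
  set μ : Rat1 := mu b Λ Z i qp qm with hμ
  -- Two forms of $\mu_i$: the definition yields the $\check\alpha_i$ coefficient, and the
  -- $qq$-equation below gives a product whose logarithmic derivative is explicit.
  have hμΛ : μ * toRat (Λ i) = dlog (toRat (qm i)) - dlog (toRat (qp i)) + ζ := by
    rw [hμ, mu, mul_comm, mul_inv_cancel_left₀ hΛ', dlog_div hm' (hp' i)]
  have hμP : μ = P / (toRat (qp i) * toRat (qm i)) := by
    have h1 := h.ratDeriv_div b (hp i)
    rw [ratDeriv_eq_mul_dlog (div_ne_zero hm' (hp' i)), rho] at h1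
    have hp'' := hp' i
    rw [hμ, mu, inv_mul_eq_iff_eq_mul₀ hΛ']
    refine mul_left_cancel₀ (div_ne_zero hm' hp'') ?_
    rw [mul_add, mul_comm _ (RatFunc.C _), h1]
    field_simp
    rfl
  have hdP : dlog P = -(∑ k, dlog (toRat (qp k)) * (b.A i k : Rat1)) + 2 * dlog (toRat (qp i)) := by
    rw [hP, dlog_prod _ _ fun k _ => zpow_ne_zero _ (hp' k),
      ← Finset.sum_erase_add _ _ (Finset.mem_univ i), A_self, neg_add, ← Finset.sum_neg_distrib]
    have : ∀ k ∈ Finset.univ.erase i, dlog (toRat (qp k) ^ (-cartanEntry b k i)) =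
        -(dlog (toRat (qp k)) * (b.A i k : Rat1)) := fun k _ => by
      rw [dlog_zpow (hp' k), cartanEntry]
      push_cast
      ring
    rw [Finset.sum_congr rfl this]
    push_cast
    ring
  have hdμ : ratDeriv μ = μ * (dlog P - dlog (toRat (qp i)) - dlog (toRat (qm i))) := by
    have hμ0 : μ ≠ 0 := hμP ▸ div_ne_zero hP' (mul_ne_zero (hp' i) hm')
    rw [ratDeriv_eq_mul_dlog hμ0]
    congr 1
    rw [hμP, dlog_div hP' (mul_ne_zero (hp' i) hm'), dlog_mul (hp' i) hm']
    ring
  -- The coefficient of $f_i$ vanishes, so the transformed connection stays in $\mathfrak b_+$.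
  have hf : μ * (ζ - ∑ j, dlog (toRat (qp j)) * (b.A i j : Rat1)) - μ ^ 2 * toRat (Λ i) -
      ratDeriv μ = 0 := by
    rw [hdμ, hdP]
    linear_combination -μ * hμΛ
  rw [backlund, solutionConnection, solutionConnection, ← hμ, gaugeExp_f, hf, zero_tmul, add_zero,
    hμΛ]
  have hsum : ∑ j, dlog (toRat (swapAt i qp qm j)) ⊗ₜ[ℂ] b.h j =
      ∑ j, dlog (toRat (qp j)) ⊗ₜ[ℂ] b.h j +
        (dlog (toRat (qm i)) - dlog (toRat (qp i))) ⊗ₜ[ℂ] b.h i := by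
    rw [← Finset.sum_erase_add _ _ (Finset.mem_univ i),
      ← Finset.sum_erase_add (a := i) Finset.univ (fun j => dlog (toRat (qp j)) ⊗ₜ[ℂ] b.h j)
        (Finset.mem_univ i), swapAt_self, sub_tmul]
    rw [Finset.sum_congr rfl fun j hj => by rw [swapAt_of_ne (Finset.ne_of_mem_erase hj)]]
    abel
  have hZ : (1 : Rat1) ⊗ₜ[ℂ] (simpleReflection b i Z : L) =
      (1 : Rat1) ⊗ₜ[ℂ] (Z : L) - ζ ⊗ₜ[ℂ] b.h i := by
    have e : ((simpleReflection b i Z : H) : L) = (Z : L) - b.baseSupp i Z • b.h i := rfl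
    rw [e, tmul_sub, ← smul_tmul, Algebra.smul_def, mul_one]
    rfl
  rw [hsum, hZ, add_tmul]
  abel

end Backlund

/-! ### The connection of a solution is a twisted Miura–Plücker oper -/

section MiuraPluckerOper

variable {ι L : Type*} [Fintype ι] [LieRing L] [LieAlgebra ℂ L]
  {H : LieSubalgebra ℂ L} (b : LieAlgebra.Basis ι H)

theorem tmul_mem_baseChange (S : LieSubalgebra ℂ L) (r : Rat1) {x : L} (hx : x ∈ S) :
    r ⊗ₜ[ℂ] x ∈ S.toSubmodule.baseChange Rat1 :=
  Submodule.tmul_mem_baseChange_of_mem r hx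

theorem sum_tmul_e_mem_nPlus (g : ι → Rat1) : ∑ j, g j ⊗ₜ[ℂ] b.e j ∈ nPlus b :=
  Submodule.sum_mem _ fun j _ => tmul_mem_baseChange _ _
    (LieSubalgebra.subset_lieSpan (Set.mem_range_self j))

theorem coe_mem_lieSpan {s : Set L} (hs : Set.range b.h ⊆ s) (Z : H) :
    (Z : L) ∈ LieSubalgebra.lieSpan ℂ L s := by
  have h := b.cartan_eq_lieSpan.le Z.2
  exact LieSubalgebra.lieSpan_mono hs h

theorem isMiuraOper_solutionConnection (Λ : ι → ℂ[X]) (Z : H) (q : ι → ℂ[X]) :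
    IsMiuraOper b Λ (solutionConnection b Λ Z q) := by
  have key : ∀ s : Set L, Set.range b.h ⊆ s →
      (1 : Rat1) ⊗ₜ[ℂ] (Z : L) - ∑ j, dlog (toRat (q j)) ⊗ₜ[ℂ] b.h j ∈
        (LieSubalgebra.lieSpan ℂ L s).toSubmodule.baseChange Rat1 := fun s hs =>
    Submodule.sub_mem _ (tmul_mem_baseChange _ _ (coe_mem_lieSpan b hs Z))
      (Submodule.sum_mem _ fun j _ => tmul_mem_baseChange _ _
        (LieSubalgebra.subset_lieSpan (hs (Set.mem_range_self j))))
  constructor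
  · rw [solutionConnection, add_sub_cancel_right]
    exact key _ Set.subset_union_right
  · refine Submodule.add_mem _ (key _ Set.subset_union_right) ?_
    exact Submodule.sum_mem _ fun j _ => tmul_mem_baseChange _ _
      (LieSubalgebra.subset_lieSpan (Or.inl (Set.mem_range_self j)))

theorem tmul_add_tmul_add {V : Type*} [AddCommGroup V] [Module ℂ V] (r s r' s' : Rat1) (u v : V) :
    r ⊗ₜ[ℂ] u + s ⊗ₜ[ℂ] v + (r' ⊗ₜ[ℂ] u + s' ⊗ₜ[ℂ] v) =
      (r + r') ⊗ₜ[ℂ] u + (s + s') ⊗ₜ[ℂ] v := by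
  rw [add_tmul, add_tmul]
  abel

theorem cartan_lie_f {V : Type*} [AddCommGroup V] [Module ℂ V] [LieRingModule L V]
    [LieModule ℂ L V] (i : ι) {ν : V} {Z : H} {ζ : ℂ} (hZ : ⁅(Z : L), ν⁆ = ζ • ν) :
    ⁅(Z : L), ⁅b.f i, ν⁆⁆ = (ζ - b.baseSupp i Z) • ⁅b.f i, ν⁆ := by
  rw [leibniz_lie, hZ, ← lie_skew, lie_f_cartan, neg_lie, smul_lie, lie_smul, sub_smul]
  abel

theorem prod_zpow_ite [DecidableEq ι] (y : ι → Rat1ˣ) (i : ι) :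
    ∏ j, y j ^ (if j = i then (1 : ℤ) else 0) = y i := by
  rw [Finset.prod_eq_single i] <;> simp +contextual

variable [DecidableEq ι]

section Fundamental

variable {V : Type*} [AddCommGroup V] [Module ℂ V] [LieRingModule L V] {i : ι} {ν : V}

theorem IsFundamental.e_lie_f (hν : IsFundamental b V i ν) (j : ι) :
    ⁅b.e j, ⁅b.f i, ν⁆⁆ = (if j = i then (1 : ℂ) else 0) • ν := by
  rw [leibniz_lie, hν.e_act, lie_zero, add_zero]
  split_ifs with h
  · rw [h, (b.sl2 i).lie_e_f, hν.h_act, if_pos rfl]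
  · rw [b.lie_e_f_ne j i h, zero_lie, zero_smul]

variable [LieModule ℂ L V]

theorem IsFundamental.h_lie_f (hν : IsFundamental b V i ν) (j : ι) :
    ⁅b.h j, ⁅b.f i, ν⁆⁆ = (((if j = i then 1 else 0) - b.A i j : ℤ) : ℂ) • ⁅b.f i, ν⁆ := by
  rw [leibniz_lie, hν.h_act, b.lie_h_f, ← Int.cast_smul_eq_zsmul ℂ, Int.cast_neg, neg_smul, neg_lie, smul_lie,
    lie_smul]
  push_cast
  rw [sub_smul]
  abel

theorem IsFundamental.cartan_lie (hν : IsFundamental b V i ν) (ζ : ι → ℂ) :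
    ⁅((∑ j, ζ j • b.h' j : H) : L), ν⁆ = ζ i • ν := by
  have e : ((∑ j, ζ j • b.h' j : H) : L) = ∑ j, ζ j • b.h j := by
    rw [AddSubmonoidClass.coe_finsetSum]
    rfl
  rw [e, sum_lie, Finset.sum_eq_single i]
  · rw [smul_lie, hν.h_act, if_pos rfl, one_smul]
  · intro j _ hj
    rw [smul_lie, hν.h_act, if_neg hj, zero_smul, smul_zero]
  · simp

/-- The weight of the highest weight vector. -/
theorem IsFundamental.tmul_mem_weightSpace (hν : IsFundamental b V i ν) (r : Rat1) :
    r ⊗ₜ[ℂ] ν ∈ weightSpace b V (fun j => if j = i then 1 else 0) := by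
  rw [weightSpace, Submodule.mem_iInf]
  intro j
  rw [Module.End.mem_eigenspace_iff, LieModule.toEnd_apply_apply,
    LieAlgebra.ExtendScalars.bracket_tmul, hν.h_act, tmul_smul_eq, one_mul, smul_tmul',
    smul_eq_mul, mul_comm]
  split_ifs <;> simp

theorem IsFundamental.tmul_f_mem_weightSpace (hν : IsFundamental b V i ν) (r : Rat1) :
    r ⊗ₜ[ℂ] ⁅b.f i, ν⁆ ∈ weightSpace b V (fun j => (if j = i then 1 else 0) - b.A i j) := by
  rw [weightSpace, Submodule.mem_iInf]
  intro j
  rw [Module.End.mem_eigenspace_iff, LieModule.toEnd_apply_apply,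
    LieAlgebra.ExtendScalars.bracket_tmul, hν.h_lie_f, tmul_smul_eq, one_mul, smul_tmul',
    smul_eq_mul, mul_comm, map_intCast]

/-- The action of `H(z)` on `W_i(z)`. -/
theorem IsFundamental.torusAct_eq (hν : IsFundamental b V i ν) (y : ι → Rat1ˣ) (r s : Rat1) :
    torusAct b y (r ⊗ₜ[ℂ] ν + s ⊗ₜ[ℂ] ⁅b.f i, ν⁆) =
      ((y i : Rat1) * r) ⊗ₜ[ℂ] ν +
        (((y i * ∏ j, y j ^ (-b.A i j) : Rat1ˣ) : Rat1) * s) ⊗ₜ[ℂ] ⁅b.f i, ν⁆ := by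
  set m₁ : ι → ℤ := fun j => if j = i then 1 else 0 with hm₁
  set m₂ : ι → ℤ := fun j => (if j = i then 1 else 0) - b.A i j with hm₂
  have hne : m₁ ≠ m₂ := fun h => by
    have := congrFun h i
    simp [hm₁, hm₂, A_self] at this
  -- The weights are $\omega_i$ and $\omega_i-\alpha_i$; the value does not depend on the
  -- decomposition chosen in `torusAct`.
  have h := MiuraPlucker.torusAct_eq b y
    (Finsupp.single m₁ (r ⊗ₜ[ℂ] ν) + Finsupp.single m₂ (s ⊗ₜ[ℂ] ⁅b.f i, ν⁆)) (fun m => by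
      rw [Finsupp.add_apply, Finsupp.single_apply, Finsupp.single_apply]
      refine Submodule.add_mem _ ?_ ?_
      · split_ifs with h
        · exact h ▸ hν.tmul_mem_weightSpace b r
        · exact Submodule.zero_mem _
      · split_ifs with h
        · exact h ▸ hν.tmul_f_mem_weightSpace b s
        · exact Submodule.zero_mem _)
  rw [Finsupp.sum_add_index' (by simp) (by simp), Finsupp.sum_single_index rfl,
    Finsupp.sum_single_index rfl, Finsupp.sum_add_index' (by simp) (by simp [smul_add]),
    Finsupp.sum_single_index (by simp), Finsupp.sum_single_index (by simp)] at h
  rw [h, smul_tmul', smul_tmul', smul_eq_mul, smul_eq_mul, hm₁, hm₂, prod_zpow_ite]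
  simp only [sub_eq_add_neg, zpow_add, Finset.prod_mul_distrib, prod_zpow_ite]

/-- The action of `exp(∑ g_j e_j)` on `W_i(z)`. -/
theorem IsFundamental.expAct_eq (hν : IsFundamental b V i ν) (g : ι → Rat1) (r s : Rat1) :
    expAct (∑ j, g j ⊗ₜ[ℂ] b.e j) (r ⊗ₜ[ℂ] ν + s ⊗ₜ[ℂ] ⁅b.f i, ν⁆) =
      (r + g i * s) ⊗ₜ[ℂ] ν + s ⊗ₜ[ℂ] ⁅b.f i, ν⁆ := by
  have h1 : ∀ t : Rat1, ⁅∑ j, g j ⊗ₜ[ℂ] b.e j, t ⊗ₜ[ℂ] ν⁆ = 0 := fun t => by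
    rw [sum_lie]
    exact Finset.sum_eq_zero fun j _ => by
      rw [LieAlgebra.ExtendScalars.bracket_tmul, hν.e_act, tmul_zero]
  have h2 : ⁅∑ j, g j ⊗ₜ[ℂ] b.e j, s ⊗ₜ[ℂ] ⁅b.f i, ν⁆⁆ = (g i * s) ⊗ₜ[ℂ] ν := by
    rw [sum_lie, Finset.sum_eq_single i]
    · rw [LieAlgebra.ExtendScalars.bracket_tmul, hν.e_lie_f, if_pos rfl, one_smul]
    · intro j _ hj
      rw [LieAlgebra.ExtendScalars.bracket_tmul, hν.e_lie_f, if_neg hj, zero_smul, tmul_zero]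
    · simp
  have h3 : ⁅∑ j, g j ⊗ₜ[ℂ] b.e j, r ⊗ₜ[ℂ] ν + s ⊗ₜ[ℂ] ⁅b.f i, ν⁆⁆ = (g i * s) ⊗ₜ[ℂ] ν := by
    rw [lie_add, h1, h2, zero_add]
  rw [expAct_eq_of_lie_lie_lie_eq_zero (by rw [h3, h1, lie_zero]), h3, h1, smul_zero, add_zero,
    add_tmul]
  abel

theorem IsFundamental.borelAct_eq (hν : IsFundamental b V i ν) (y : ι → Rat1ˣ) (g : ι → Rat1)
    (r s : Rat1) :
    borelAct b y (∑ j, g j ⊗ₜ[ℂ] b.e j) (r ⊗ₜ[ℂ] ν + s ⊗ₜ[ℂ] ⁅b.f i, ν⁆) =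
      ((y i : Rat1) * (r + g i * s)) ⊗ₜ[ℂ] ν +
        (((y i * ∏ j, y j ^ (-b.A i j) : Rat1ˣ) : Rat1) * s) ⊗ₜ[ℂ] ⁅b.f i, ν⁆ := by
  rw [borelAct, hν.expAct_eq, hν.torusAct_eq]

/-- The action of the connection of a solution on `W_i(z)`. -/
theorem IsFundamental.solutionConnection_lie (hν : IsFundamental b V i ν) {Λ q : ι → ℂ[X]} {Z : H}
    {ζ : ℂ} (hZ : ⁅(Z : L), ν⁆ = ζ • ν) (r s : Rat1) :
    ⁅solutionConnection b Λ Z q, r ⊗ₜ[ℂ] ν + s ⊗ₜ[ℂ] ⁅b.f i, ν⁆⁆ =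
      (r * (RatFunc.C ζ - dlog (toRat (q i))) + toRat (Λ i) * s) ⊗ₜ[ℂ] ν +
      (s * (RatFunc.C ζ - RatFunc.C (b.baseSupp i Z) - dlog (toRat (q i)) +
        ∑ j, dlog (toRat (q j)) * (b.A i j : Rat1))) ⊗ₜ[ℂ] ⁅b.f i, ν⁆ := by
  have hZ' := cartan_lie_f b i hZ
  have e1 : ⁅∑ j, toRat (Λ j) ⊗ₜ[ℂ] b.e j, r ⊗ₜ[ℂ] ν⁆ = 0 := by
    rw [sum_lie]
    exact Finset.sum_eq_zero fun j _ => by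
      rw [LieAlgebra.ExtendScalars.bracket_tmul, hν.e_act, tmul_zero]
  have e2 : ⁅∑ j, toRat (Λ j) ⊗ₜ[ℂ] b.e j, s ⊗ₜ[ℂ] ⁅b.f i, ν⁆⁆ = (toRat (Λ i) * s) ⊗ₜ[ℂ] ν := by
    rw [sum_lie, Finset.sum_eq_single i]
    · rw [LieAlgebra.ExtendScalars.bracket_tmul, hν.e_lie_f, if_pos rfl, one_smul]
    · intro j _ hj
      rw [LieAlgebra.ExtendScalars.bracket_tmul, hν.e_lie_f, if_neg hj, zero_smul, tmul_zero]
    · simp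
  have e3 : ⁅∑ j, dlog (toRat (q j)) ⊗ₜ[ℂ] b.h j, r ⊗ₜ[ℂ] ν⁆ =
      (dlog (toRat (q i)) * r) ⊗ₜ[ℂ] ν := by
    rw [sum_lie, Finset.sum_eq_single i]
    · rw [LieAlgebra.ExtendScalars.bracket_tmul, hν.h_act, if_pos rfl, one_smul]
    · intro j _ hj
      rw [LieAlgebra.ExtendScalars.bracket_tmul, hν.h_act, if_neg hj, zero_smul, tmul_zero]
    · simp
  have e4 : ⁅∑ j, dlog (toRat (q j)) ⊗ₜ[ℂ] b.h j, s ⊗ₜ[ℂ] ⁅b.f i, ν⁆⁆ =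
      (s * (dlog (toRat (q i)) - ∑ j, dlog (toRat (q j)) * (b.A i j : Rat1))) ⊗ₜ[ℂ]
        ⁅b.f i, ν⁆ := by
    have e : ∀ j, ⁅dlog (toRat (q j)) ⊗ₜ[ℂ] b.h j, s ⊗ₜ[ℂ] ⁅b.f i, ν⁆⁆ =
        (s * ((if j = i then dlog (toRat (q j)) else 0) -
          dlog (toRat (q j)) * (b.A i j : Rat1))) ⊗ₜ[ℂ] ⁅b.f i, ν⁆ := fun j => by
      rw [LieAlgebra.ExtendScalars.bracket_tmul, hν.h_lie_f, tmul_smul_eq, map_intCast]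
      congr 1
      split_ifs <;> push_cast <;> ring
    rw [sum_lie, Finset.sum_congr rfl fun j _ => e j, ← sum_tmul, ← Finset.mul_sum,
      Finset.sum_sub_distrib, Finset.sum_ite_eq' Finset.univ i, if_pos (Finset.mem_univ i)]
  rw [solutionConnection, add_lie, sub_lie, lie_add, lie_add, lie_add, e1, e2, e3, e4,
    LieAlgebra.ExtendScalars.bracket_tmul, LieAlgebra.ExtendScalars.bracket_tmul, hZ, hZ',
    tmul_smul_eq, tmul_smul_eq, one_mul, one_mul, zero_add]
  rw [show ∀ a b c d e : Rat1 ⊗[ℂ] V, a + b - (c + d) + e = (a - c + e) + (b - d) from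
    fun a b c d e => by abel, ← sub_tmul, ← add_tmul, ← sub_tmul]
  congr 2
  · ring
  · rw [map_sub]
    ring

end Fundamental

/-- The connection of a solution with nonzero positive part is a twisted Miura–Plücker oper. -/
theorem isTwistedMiuraPlucker_solutionConnection [FiniteDimensional ℂ L] {Λ : ι → ℂ[X]} {Z : H}
    {qp qm : ι → ℂ[X]} (h : IsSolution b Λ Z qp qm) (hp : ∀ j, qp j ≠ 0) {ζ : ι → ℂ}
    (hZ : Z = ∑ j, ζ j • b.h' j) :
    IsTwistedMiuraPlucker b Λ Z (solutionConnection b Λ Z qp) := by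
  have hp' : ∀ j, toRat (qp j) ≠ 0 := fun j => toRat_ne_zero (hp j)
  refine ⟨isMiuraOper_solutionConnection b Λ Z qp, fun j => Units.mk0 _ (hp' j),
    ∑ j, (-(toRat (qm j) / toRat (qp j))) ⊗ₜ[ℂ] b.e j, sum_tmul_e_mem_nPlus b _, ?_⟩
  intro i V _ _ _ _ ν hν w hw
  obtain ⟨r, s, rfl⟩ := Submodule.mem_span_pair.mp hw
  have hZν : ⁅(Z : L), ν⁆ = ζ i • ν := by rw [hZ, hν.cartan_lie b]
  set y : Rat1 := toRat (qp i) with hy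
  set g : Rat1 := toRat (qm i) / y with hg
  set T : Rat1 := ∏ j, toRat (qp j) ^ (-b.A i j) with hT
  have hT0 : T ≠ 0 := Finset.prod_ne_zero_iff.mpr fun k _ => zpow_ne_zero _ (hp' k)
  have hTu : ((Units.mk0 y (hp' i) * ∏ j, (Units.mk0 _ (hp' j)) ^ (-b.A i j) : Rat1ˣ) : Rat1) =
      y * T := by
    simp [hT, Units.coe_prod]
  -- The diagonal entry $2$ contributes $y^{-2}$ to `T`, so $y^2$ cancels the $i$-th factor.
  have hTe : T * y ^ 2 = ∏ k ∈ Finset.univ.erase i, toRat (qp k) ^ (-cartanEntry b k i) := by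
    rw [hT, ← Finset.prod_erase_mul _ _ (Finset.mem_univ i), A_self, mul_assoc, ← hy,
      zpow_neg, zpow_ofNat, inv_mul_cancel₀ (pow_ne_zero 2 (hp' i)), mul_one]
    rfl
  have hdT : ratDeriv T = -(T * ∑ j, dlog (toRat (qp j)) * (b.A i j : Rat1)) := by
    rw [ratDeriv_eq_mul_dlog hT0, hT, dlog_prod _ _ fun k _ => zpow_ne_zero _ (hp' k), ← mul_neg,
      ← Finset.sum_neg_distrib]
    congr 1
    refine Finset.sum_congr rfl fun k _ => ?_
    rw [dlog_zpow (hp' k)]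
    push_cast
    ring
  have hdg : ratDeriv g + RatFunc.C (b.baseSupp i Z) * g = toRat (Λ i) * T := by
    rw [hg, hy, h.ratDeriv_div b (hp i), rho, ← hTe, ← hy, ← mul_assoc,
      mul_div_cancel_right₀ _ (pow_ne_zero 2 (hp' i))]
  have hdy : ratDeriv y = y * dlog y := ratDeriv_eq_mul_dlog (hp' i)
  have hZw : ⁅(1 : Rat1) ⊗ₜ[ℂ] (Z : L), r ⊗ₜ[ℂ] ν + s ⊗ₜ[ℂ] ⁅b.f i, ν⁆⁆ =
      (r * RatFunc.C (ζ i)) ⊗ₜ[ℂ] ν +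
        (s * (RatFunc.C (ζ i) - RatFunc.C (b.baseSupp i Z))) ⊗ₜ[ℂ] ⁅b.f i, ν⁆ := by
    rw [lie_add, LieAlgebra.ExtendScalars.bracket_tmul, LieAlgebra.ExtendScalars.bracket_tmul, hZν,
      cartan_lie_f b i hZν, tmul_smul_eq, tmul_smul_eq, one_mul, one_mul, map_sub]
  rw [smul_tmul', smul_tmul', smul_eq_mul, smul_eq_mul, mul_one, mul_one, hZw, hν.borelAct_eq,
    hν.solutionConnection_lie b hZν, map_add, map_add, coeffDeriv_tmul, coeffDeriv_tmul,
    coeffDeriv_tmul, coeffDeriv_tmul]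
  rw [tmul_add_tmul_add, tmul_add_tmul_add, hν.borelAct_eq]
  simp only [Units.val_mk0, hTu, ← hy, ← hg, ratDeriv_mul, map_add, map_neg, hdT, hdy]
  congr 2
  -- The $\nu$-component is the $i$-th $qq$-equation; the $f_i\nu$-component is an identity between
  -- logarithmic derivatives.
  · linear_combination (-y * s) * hdg
  · ring

end MiuraPluckerOper

/-! ### Nondegeneracy and uniqueness -/

section Nondegeneracy

variable {ι L : Type*} [Fintype ι] [LieRing L] [LieAlgebra ℂ L]
  {H : LieSubalgebra ℂ L} (b : LieAlgebra.Basis ι H)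

theorem exists_eq_sum_h' (Z : H) : ∃ ζ : ι → ℂ, Z = ∑ j, ζ j • b.h' j := by
  have h : (Z : L) ∈ Submodule.span ℂ (Set.range b.h) := b.coe_cartan_eq_span.le Z.2
  obtain ⟨ζ, hζ⟩ := (Submodule.mem_span_range_iff_exists_fun ℂ).mp h
  refine ⟨ζ, Subtype.ext ?_⟩
  rw [← hζ, AddSubmonoidClass.coe_finsetSum]
  rfl

/-- Linear independence over $\mathbb C$ survives extension of scalars: a $\mathbb C$-linear left
inverse of the coordinate map, tensored with $\mathbb C(z)$, reads off each coefficient. -/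
theorem eq_of_sum_tmul_h_eq {g g' : ι → Rat1}
    (h : ∑ j, g j ⊗ₜ[ℂ] b.h j = ∑ j, g' j ⊗ₜ[ℂ] b.h j) : g = g' := by
  classical
  obtain ⟨φ, hφ⟩ := LinearMap.exists_leftInverse_of_injective (Fintype.linearCombination ℂ b.h)
    (LinearMap.ker_eq_bot.mpr 
      (linearIndependent_iff_injective_fintypeLinearCombination.mp b.linInd))
  have hφh : ∀ j, φ (b.h j) = Pi.single j 1 := fun j => by
    have := LinearMap.congr_fun hφ (Pi.single j 1)
    simpa [Fintype.linearCombination_apply_single] using this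
  funext k
  have key : ∀ u : ι → Rat1, TensorProduct.rid ℂ Rat1
      (((LinearMap.proj k).comp φ).lTensor Rat1 (∑ j, u j ⊗ₜ[ℂ] b.h j)) = u k := fun u => by
    rw [map_sum, map_sum, Finset.sum_eq_single k]
    · simp [hφh]
    · intro j _ hj
      simp [hφh, Pi.single_eq_of_ne hj.symm]
    · simp
  rw [← key g, ← key g', h]

theorem dlog_eq_of_solutionConnection_eq {Λ : ι → ℂ[X]} {Z : H} {p q : ι → ℂ[X]}
    (h : solutionConnection b Λ Z p = solutionConnection b Λ Z q) (j : ι) :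
    dlog (toRat (p j)) = dlog (toRat (q j)) :=
  congrFun (eq_of_sum_tmul_h_eq b (sub_right_injective (add_right_cancel h))) j

theorem solutionConnection_congr {Λ : ι → ℂ[X]} {Z : H} {p q : ι → ℂ[X]}
    (h : ∀ j, dlog (toRat (p j)) = dlog (toRat (q j))) :
    solutionConnection b Λ Z p = solutionConnection b Λ Z q := by
  simp only [solutionConnection, h]

variable [DecidableEq ι] [FiniteDimensional ℂ L]

/-- The associated `SL(2)`-opers of a nondegenerate tuple of polynomials are nondegenerate. -/
theorem isNondegenerateSL2_sl2Oper {Λ : ι → ℂ[X]} {q : ι → ℂ[X]}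
    (h : HNondegCond (cartanEntry b) Λ (fun j => toRat (q j))) (ζ : ι → ℂ) (i : ι) :
    IsNondegenerateSL2 (ζ i) (sl2Oper b Λ ζ (fun j => toRat (q j)) i) := by
  obtain ⟨h1, h2, h3, h4⟩ := (hNondegCond_toRat_iff _ _ _).mp h
  refine ⟨Λ i * ∏ k ∈ Finset.univ.erase i, q k ^ (-cartanEntry b k i).toNat, q i, ?_, ?_⟩
  · rw [toRat_rhs, sl2Oper]
  -- With a single index the pairwise condition is void. A root of $\rho_i$ is a root of $\Lambda_i$
  -- or of a neighbouring $q^k_+$, and both kinds are excluded.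
  · refine (hNondegCond_toRat_iff _ _ _).mpr ⟨fun _ => h1 i, fun _ => h2 i, fun _ w hw => ?_,
      fun _ _ hne => absurd rfl hne⟩
    rcases isRoot_rhs b hw with hw | ⟨k, hk, hA, hw⟩
    · exact h3 i w hw
    · exact h4 k i hk hA w hw

/-- The connection of a nondegenerate solution is a nondegenerate twisted Miura–Plücker oper. -/
theorem isNondegTwistedMiuraPlucker_solutionConnection {Λ : ι → ℂ[X]} {Z : H} {qp qm : ι → ℂ[X]}
    (h : IsSolution b Λ Z qp qm) (hq : HNondegCond (cartanEntry b) Λ (fun j => toRat (qp j))) :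
    IsNondegTwistedMiuraPlucker b Λ Z (solutionConnection b Λ Z qp) := by
  obtain ⟨ζ, hζ⟩ := exists_eq_sum_h' b Z
  have h1 := ((hNondegCond_toRat_iff _ _ _).mp hq).1
  refine ⟨isTwistedMiuraPlucker_solutionConnection b h h1 hζ, ζ, fun j => toRat (qp j), hζ, ?_, hq,
    isNondegenerateSL2_sl2Oper b hq ζ⟩
  have hZ : (1 : Rat1) ⊗ₜ[ℂ] (Z : L) = ∑ j, RatFunc.C (ζ j) ⊗ₜ[ℂ] b.h j := by
    have e : (Z : L) = ∑ j, ζ j • b.h j := by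
      rw [hζ, AddSubmonoidClass.coe_finsetSum]
      rfl
    rw [e, tmul_sum]
    exact Finset.sum_congr rfl fun j _ => by rw [tmul_smul_eq, one_mul]
  have e : solutionConnection b Λ Z qp -
      ∑ j, (RatFunc.C (ζ j) - dlog (toRat (qp j))) ⊗ₜ[ℂ] b.h j =
      ∑ j, toRat (Λ j) ⊗ₜ[ℂ] b.e j := by
    simp only [solutionConnection, hZ, sub_tmul, Finset.sum_sub_distrib]
    abel
  rw [e]
  exact sum_tmul_e_mem_nPlus b _

end Nondegeneracy

theorem hNondegCond_C_mul {κ : Type*} {a : κ → κ → ℤ} {Λ q : κ → ℂ[X]} {c : κ → ℂ}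
    (hc : ∀ j, c j ≠ 0) (h : HNondegCond a Λ (fun j => toRat (q j))) :
    HNondegCond a Λ (fun j => toRat (C (c j) * q j)) := by
  obtain ⟨h1, h2, h3, h4⟩ := (hNondegCond_toRat_iff _ _ _).mp h
  have hroot : ∀ j w, (C (c j) * q j).IsRoot w ↔ (q j).IsRoot w := fun j w => by
    rw [root_mul, or_iff_right (not_isRoot_C _ _ (hc j))]
  refine (hNondegCond_toRat_iff _ _ _).mpr
    ⟨fun j => mul_ne_zero (C_ne_zero.mpr (hc j)) (h1 j), fun j w => ?_, fun j w hw => ?_,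
      fun j k hjk ha w => ?_⟩
  · rw [← count_roots, roots_C_mul _ (hc j), count_roots]
    exact h2 j w
  · rw [hroot]
    exact h3 j w hw
  · rw [hroot, hroot]
    exact h4 j k hjk ha w

end MiuraPlucker

end

theorem lemma6p4 {ι L : Type*} [Fintype ι] [DecidableEq ι] [LieRing L] [LieAlgebra ℂ L]
    [FiniteDimensional ℂ L] [LieAlgebra.IsSimple ℂ L] {H : LieSubalgebra ℂ L}
    (b : LieAlgebra.Basis ι H) (Λ : ι → Polynomial ℂ) (hΛ : ∀ j, (Λ j).Monic) (Z : H)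
    (i : ι) (qp qm : ι → Polynomial ℂ)
    (hq : MiuraPlucker.IsGenericSolution b Λ Z i qp qm) :
    -- the solution is `i`-composable
    MiuraPlucker.IsComposableSolution b Λ Z i qp qm ∧
    -- the transformed connection is a nondegenerate `s_i(Z)`-twisted Miura–Plücker oper
    MiuraPlucker.IsNondegTwistedMiuraPlucker b Λ (MiuraPlucker.simpleReflection b i Z)
      (MiuraPlucker.backlund b Λ Z i qp qm) ∧
    -- every corresponding solution is nondegenerate and has the stated positive part
    (∀ rp rm : ι → Polynomial ℂ,
      MiuraPlucker.IsSolution b Λ (MiuraPlucker.simpleReflection b i Z) rp rm →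
      (∀ j, (rp j).Monic) →
      MiuraPlucker.solutionConnection b Λ (MiuraPlucker.simpleReflection b i Z) rp =
        MiuraPlucker.backlund b Λ Z i qp qm →
      MiuraPlucker.IsNondegenerate b Λ rp ∧ (∀ j, j ≠ i → rp j = qp j) ∧
        Polynomial.C (qm i).leadingCoeff * rp i = qm i) ∧
    -- there is a solution with positive part `q^i_-`, `q^j_+` and with `i`-th negative part
    -- `-q^i_+`, and it corresponds to the transformed connection
    (∃ rm : ι → Polynomial ℂ,
      MiuraPlucker.IsSolution b Λ (MiuraPlucker.simpleReflection b i Z)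
        (MiuraPlucker.swapAt i qp qm) rm ∧
      rm i = -qp i ∧
      MiuraPlucker.solutionConnection b Λ (MiuraPlucker.simpleReflection b i Z)
        (MiuraPlucker.swapAt i qp qm) = MiuraPlucker.backlund b Λ Z i qp qm) ∧
    -- the same with `q^i_-` made monic
    (∃ rp rm : ι → Polynomial ℂ,
      MiuraPlucker.IsSolution b Λ (MiuraPlucker.simpleReflection b i Z) rp rm ∧
      MiuraPlucker.IsNondegenerate b Λ rp ∧
      (∀ j, j ≠ i → rp j = qp j) ∧
      Polynomial.C (qm i).leadingCoeff * rp i = qm i ∧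
      rm i = -(Polynomial.C (qm i).leadingCoeff * qp i) ∧
      MiuraPlucker.solutionConnection b Λ (MiuraPlucker.simpleReflection b i Z) rp =
        MiuraPlucker.backlund b Λ Z i qp qm) := by
  classical
  obtain ⟨hsol, hnd, hnd'⟩ := hq
  have hp : ∀ j, qp j ≠ 0 := fun j => (hnd.1 j).ne_zero
  have hs : ∀ j, MiuraPlucker.swapAt i qp qm j ≠ 0 :=
    ((MiuraPlucker.hNondegCond_toRat_iff _ _ _).mp hnd').1
  have hm : qm i ≠ 0 := by simpa only [MiuraPlucker.swapAt_self] using hs i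
  obtain ⟨rm, hrm, hrmi⟩ := MiuraPlucker.exists_solution_swapAt b ⟨hsol, hnd, hnd'⟩
  have hconn := MiuraPlucker.solutionConnection_swapAt b (fun j => (hΛ j).ne_zero) hsol hp hm
  set c : ℂ := (qm i).leadingCoeff with hc
  have hc0 : c ≠ 0 := Polynomial.leadingCoeff_ne_zero.mpr hm
  -- the monic normalization of the positive part
  set γ : ι → ℂ := Function.update (fun _ => 1) i c⁻¹ with hγ
  have hγi : γ i = c⁻¹ := Function.update_self ..
  have hγj : ∀ j, j ≠ i → γ j = 1 := fun j hj => Function.update_of_ne hj ..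
  have hγ0 : ∀ j, γ j ≠ 0 := fun j => by
    rcases eq_or_ne j i with rfl | hj
    · rw [hγi]
      exact inv_ne_zero hc0
    · rw [hγj j hj]
      exact one_ne_zero
  -- These factors for the negative part are forced by the hypothesis of `IsSolution.rescale`. At
  -- $i$ the product only involves $\gamma_k=1$, hence $\delta_i=c$.
  set δ : ι → ℂ := fun j =>
    (γ j)⁻¹ * ∏ k ∈ Finset.univ.erase j, γ k ^ (-MiuraPlucker.cartanEntry b k j).toNat with hδ
  have hδi : δ i = c := by
    simp only [hδ, hγi, inv_inv]
    rw [Finset.prod_eq_one fun k hk => by rw [hγj k (Finset.ne_of_mem_erase hk), one_pow], mul_one]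
  set sp : ι → Polynomial ℂ :=
    fun j => Polynomial.C (γ j) * MiuraPlucker.swapAt i qp qm j with hsp
  have hspi : Polynomial.C c * sp i = qm i := by
    simp only [hsp, MiuraPlucker.swapAt_self, hγi]
    rw [← mul_assoc, ← Polynomial.C_mul, mul_inv_cancel₀ hc0, Polynomial.C_1, one_mul]
  have hspj : ∀ j, j ≠ i → sp j = qp j := fun j hj => by
    simp only [hsp, hγj j hj, MiuraPlucker.swapAt_of_ne hj, Polynomial.C_1, one_mul]
  have hspm : ∀ j, (sp j).Monic := fun j => by
    rcases eq_or_ne j i with rfl | hj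
    · simp only [hsp, MiuraPlucker.swapAt_self, hγi]
      exact Polynomial.monic_C_mul_of_mul_leadingCoeff_eq_one (inv_mul_cancel₀ hc0)
    · rw [hspj j hj]
      exact hnd.1 j
  have hspdlog : ∀ j, MiuraPlucker.dlog (MiuraPlucker.toRat (sp j)) =
      MiuraPlucker.dlog (MiuraPlucker.toRat (MiuraPlucker.swapAt i qp qm j)) := fun j =>
    MiuraPlucker.dlog_toRat_C_mul (hγ0 j) (hs j)
  have hspnd : MiuraPlucker.IsNondegenerate b Λ sp :=
    ⟨hspm, MiuraPlucker.hNondegCond_C_mul hγ0 hnd'⟩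
  refine ⟨⟨hsol, rm, hrm⟩, ?_, ?_, ⟨rm, hrm, hrmi, hconn⟩,
    sp, fun j => Polynomial.C (δ j) * rm j, ?_, hspnd, hspj, hspi, ?_, ?_⟩
  · rw [← hconn]
    exact MiuraPlucker.isNondegTwistedMiuraPlucker_solutionConnection b hrm hnd'
  · intro rp rm' _ hmonic hrp
    -- Both families are monic, and their connections agree because rescaling by constants does not
    -- change logarithmic derivatives.
    have hrpsp : rp = sp := funext fun j =>
      MiuraPlucker.eq_of_dlog_eq_of_monic (hmonic j) (hspm j)
        ((MiuraPlucker.dlog_eq_of_solutionConnection_eq b (hrp.trans hconn.symm) j).trans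
          (hspdlog j).symm)
    rw [hrpsp]
    exact ⟨hspnd, hspj, hspi⟩
  · exact hrm.rescale b γ δ fun j => mul_inv_cancel_left₀ (hγ0 j) _
  · simp only [hδi, hrmi, mul_neg]
  · rw [← hconn]
    exact MiuraPlucker.solutionConnection_congr b hspdlog
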